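/- Let $\mathbb T=\mathbb R/2\pi\mathbb Z$, and let $H^1(\mathbb T)$ be the space of real-valued $f\in L^2(\mathbb T)$ with $\|f\|_{H^1}=\|(1-\partial_x^2)^{1/2}f\|_{L^2(\mathbb T)}<\infty$. Let $u_0\in H^1(\mathbb T)$ satisfy $$\int_{\mathbb T}u_0(x)\,dx\ge 0\qquad\text{and}\qquad \|u_0\|_{L^\infty(\mathbb T)}<3,$$ and let $u\in C(\mathbb R;H^1(\mathbb T))$ be the solution of the Benjamin-Bona-Mahony equation $$u_t-u_{txx}+u_x+uu_x=0,\quad x\in\mathbb T,\ t\in\mathbb R,\qquad u(x,0)=u_0(x),$$ the equation being understood in the sense of distributions. Assume that $$u(x,t)=0\qquad\text{for all }(x,t)\in\omega\times(0,T),$$ where $\omega\subset\mathbb T$ is a nonempty open set and $T>0$. Then $u_0=0$, and hence $u\equiv 0$ on $\mathbb T\times\mathbb R$. -/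

import Mathlib

open MeasureTheory Filter Topology Set

noncomputable section

namespace BBM

open scoped ContDiff

instance fact_two_pi_pos : Fact (0 < 2 * Real.pi) := ⟨Real.two_pi_pos⟩

/-- The torus `ℝ / 2πℤ`; its `volume` has total mass `2π`. -/
abbrev Torus : Type := AddCircle (2 * Real.pi)

/-- The `k`-th Fourier coefficient `(2π)⁻¹ ∫ f(x) e^{-ikx} dx` of a real function on the torus. -/
def coeff (f : Torus → ℝ) (k : ℤ) : ℂ := fourierCoeff (fun x : Torus => (f x : ℂ)) k

/-- `f` represents an element of the real Sobolev space `H^s`, `s ≥ 0`, of the torus: `f` is square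
integrable and `(1 - ∂ₓ²)^{s/2} f`, with Fourier coefficients `(1 + k²)^{s/2} f̂(k)`, is in `L²`. -/
def MemHs (s : ℝ) (f : Torus → ℝ) : Prop :=
  MemLp f 2 volume ∧ Summable fun k : ℤ => (1 + (k : ℝ) ^ 2) ^ s * ‖coeff f k‖ ^ 2

/-- The norm `‖(1 - ∂ₓ²)^{s/2} f‖_{L²}` of `H^s` (by Parseval). -/
def hsNorm (s : ℝ) (f : Torus → ℝ) : ℝ :=
  Real.sqrt (2 * Real.pi * ∑' k : ℤ, (1 + (k : ℝ) ^ 2) ^ s * ‖coeff f k‖ ^ 2)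

/-- `u ∈ C(ℝ; H^s)`, with `u t` the function `x ↦ u(x, t)`. -/
def ContinuousInHs (s : ℝ) (u : ℝ → Torus → ℝ) : Prop :=
  (∀ t, MemHs s (u t)) ∧
    ∀ t₀, Tendsto (fun t => hsNorm s (fun x => u t x - u t₀ x)) (𝓝 t₀) (𝓝 0)

/-- The equation `u_t - u_txx + u_x + u u_x = 0` in the sense of distributions on `ℝ × 𝕋`, with
`u u_x = (u²/2)_x`, tested on the products `θ(t) ψ(x)` of a smooth compactly supported `θ` and a
smooth `2π`-periodic `ψ`. -/
def SolvesBBMWeakly (u : ℝ → Torus → ℝ) : Prop :=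
  ∀ θ ψ : ℝ → ℝ, ContDiff ℝ ∞ θ → HasCompactSupport θ →
    ContDiff ℝ ∞ ψ → Function.Periodic ψ (2 * Real.pi) →
    ∫ t : ℝ, ∫ x in (0 : ℝ)..(2 * Real.pi),
      (u t (x : Torus) * (-(deriv θ t * ψ x) + deriv θ t * deriv (deriv ψ) x - θ t * deriv ψ x)
        - u t (x : Torus) ^ 2 / 2 * (θ t * deriv ψ x)) = 0

/-- `u` is a solution in `C(ℝ; H^s)` of the initial value problem of the BBM equation with initial
value `u₀`. -/
structure IsSolution (s : ℝ) (u₀ : Torus → ℝ) (u : ℝ → Torus → ℝ) : Prop where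
  continuousInHs : ContinuousInHs s u
  weak : SolvesBBMWeakly u
  initial : u 0 =ᵐ[volume] u₀

end BBM

end

/-! Applying `(1 - ∂ₓ²)⁻¹` turns the equation into `U' = K (U + U² / 2)` with `K = -∂ₓ (1 - ∂ₓ²)⁻¹`,
an ordinary differential equation in the Banach algebra of continuous functions on the torus, where
`K` is bounded. It conserves the mean, the `H¹` energy and `∫ (u³ + 3u²)`. By the energy law `‖U t‖
≤ M` for all times.

The bound `M` controls all Taylor coefficients in time geometrically, with constants independent of
the time of expansion (`norm_taylorCoeff_le`). So `t ↦ U t x` is analytic with a uniform radius, and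
its vanishing on `(0, T)` persists for all `t ≥ 0` (`SolvesODE.apply_eq_zero`). The solution is thus
zero on `ω` for all later times.

A smooth function on the torus cannot have derivative `1` everywhere, but some periodic `ψ` has `ψ'
= 1` outside `ω`. Then `F = ∫ u (ψ - ψ'')` is bounded in time, while `F' = ∫ (u + u² / 2) ψ' = ∫ u +
½ ∫ u²` because `u = 0` on `ω`. The mean is nonnegative, and `u³ + 3u² = (u + 3) u²` gives `|∫ (u³ +
3u²)| ≤ (M + 3) ∫ u²`. A nonzero cubic invariant would force `F` to grow linearly, so the invariant
is zero (`avg_cubic_eq_zero_of_multiplier`). Since `u₀ > -3`, the integrand `(u₀ + 3) u₀²` is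
nonnegative, hence `u₀ = 0`; conservation of energy then gives `u ≡ 0`. -/

noncomputable section

namespace BBM

open scoped ContDiff

/-! ### Unique continuation from Taylor coefficients -/

section Taylor

variable {E : Type*} [NormedAddCommGroup E] [NormedSpace ℝ E] {g : ℕ → ℝ → E}

/-- Here `g n` stands for the Taylor coefficient `f⁽ⁿ⁾ / n!`. As all of them vanish at `t₀`,
integrating `m` times from `t₀` leaves only the remainder of order `m`. -/
lemma norm_le_of_taylor (hg : ∀ n t, HasDerivAt (g n) (((n : ℝ) + 1) • g (n + 1) t) t)
    {M R t₀ : ℝ} (hb : ∀ n t, t₀ ≤ t → ‖g n t‖ ≤ M * R ^ n) (h0 : ∀ n, g n t₀ = 0) (m : ℕ) :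
    ∀ n t, t₀ ≤ t → ‖g n t‖ ≤ M * R ^ (n + m) * (n + m).choose m * (t - t₀) ^ m := by
  induction m with
  | zero => intro n t ht; simpa using hb n t ht
  | succ m ih =>
    intro n t ht
    -- This identity makes `n + 1` times the order-`m` bound for `g (n + 1)` the derivative of the
    -- order-`m + 1` bound for `g n`.
    have hc : ((n : ℝ) + 1) * ((n + 1 + m).choose m) = ((n + (m + 1)).choose (m + 1)) * (m + 1) := by
      have h1 := Nat.add_choose_mul_factorial_mul_factorial (n + 1) m
      have h2 := Nat.add_choose_mul_factorial_mul_factorial n (m + 1)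
      have h3 : n + 1 + m = n + (m + 1) := by ring
      rw [h3] at h1 ⊢
      rw [← h2] at h1
      have h4 : 0 < n.factorial * m.factorial := by positivity
      rw [Nat.factorial_succ, Nat.factorial_succ] at h1
      have h5 : (n + 1) * (n + (m + 1)).choose m = (n + (m + 1)).choose (m + 1) * (m + 1) := by
        apply Nat.eq_of_mul_eq_mul_right h4
        linarith
      exact_mod_cast h5
    have key := image_norm_le_of_norm_deriv_right_le_deriv_boundary (a := t₀) (b := t)
      (f := g n) (f' := fun s => ((n : ℝ) + 1) • g (n + 1) s)
      (B := fun s => M * R ^ (n + (m + 1)) * (n + (m + 1)).choose (m + 1) * (s - t₀) ^ (m + 1))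
      (B' := fun s => M * R ^ (n + (m + 1)) * (n + (m + 1)).choose (m + 1) *
        ((m + 1) * (s - t₀) ^ m))
      (fun s _ => (hg n s).continuousAt.continuousWithinAt)
      (fun s _ => (hg n s).hasDerivWithinAt)
      (by simp [h0])
      (fun s => by
        have := (((hasDerivAt_id s).sub_const t₀).pow (m + 1)).const_mul
          (M * R ^ (n + (m + 1)) * (n + (m + 1)).choose (m + 1))
        simpa using this)
      (fun s hs => by
        have h := ih (n + 1) s hs.1
        rw [norm_smul, Real.norm_of_nonneg (by positivity)]
        calc ((n : ℝ) + 1) * ‖g (n + 1) s‖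
            ≤ ((n : ℝ) + 1) * (M * R ^ (n + 1 + m) * (n + 1 + m).choose m * (s - t₀) ^ m) := by
              gcongr
          _ = M * R ^ (n + 1 + m) * (((n : ℝ) + 1) * (n + 1 + m).choose m) * (s - t₀) ^ m := by
              ring
          _ = _ := by rw [hc, show n + 1 + m = n + (m + 1) by ring]; ring)
    exact key (right_mem_Icc.2 ht)

/-- Bounding the binomial by `2 ^ (n + m)` makes the remainder geometric in `m` with ratio `2R(t -
t₀) < 1`. The step `1 / (2R)` does not depend on `t₀`. -/
lemma eq_zero_near_of_taylor (hg : ∀ n t, HasDerivAt (g n) (((n : ℝ) + 1) • g (n + 1) t) t)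
    {M R t₀ : ℝ} (hM : 0 ≤ M) (hR : 0 < R) (hb : ∀ n t, t₀ ≤ t → ‖g n t‖ ≤ M * R ^ n)
    (h0 : ∀ n, g n t₀ = 0) {t : ℝ} (ht : t₀ ≤ t) (ht' : t < t₀ + 1 / (2 * R)) (n : ℕ) :
    g n t = 0 := by
  have hq : 2 * R * (t - t₀) < 1 := by
    have : t - t₀ < 1 / (2 * R) := by linarith
    rw [lt_div_iff₀ (by positivity)] at this
    linarith
  have hq0 : 0 ≤ 2 * R * (t - t₀) := mul_nonneg (by positivity) (by linarith)
  have hlim : Tendsto (fun m : ℕ => M * (2 * R) ^ n * (2 * R * (t - t₀)) ^ m) atTop (𝓝 0) := by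
    simpa using (tendsto_pow_atTop_nhds_zero_of_lt_one hq0 hq).const_mul (M * (2 * R) ^ n)
  have hle : ‖g n t‖ ≤ 0 := by
    refine ge_of_tendsto' hlim fun m => ?_
    have hts : 0 ≤ t - t₀ := by linarith
    refine (norm_le_of_taylor hg hb h0 m n t ht).trans ?_
    have hc : ((n + m).choose m : ℝ) ≤ 2 ^ (n + m) := by
      exact_mod_cast Nat.choose_le_two_pow _ _
    calc M * R ^ (n + m) * (n + m).choose m * (t - t₀) ^ m
        ≤ M * R ^ (n + m) * 2 ^ (n + m) * (t - t₀) ^ m := by gcongr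
      _ = _ := by rw [mul_pow, mul_pow, mul_pow, pow_add, pow_add]; ring
  exact norm_le_zero_iff.1 hle

lemma eq_zero_of_taylor (hg : ∀ n t, HasDerivAt (g n) (((n : ℝ) + 1) • g (n + 1) t) t)
    {M R T : ℝ} (hM : 0 ≤ M) (hR : 0 < R) (hb : ∀ n t, ‖g n t‖ ≤ M * R ^ n)
    (hT : 0 < T) (h0 : ∀ t ∈ Ioo 0 T, g 0 t = 0) {t : ℝ} (ht : 0 ≤ t) : g 0 t = 0 := by
  have hcont : ∀ n, Continuous (g n) := fun n =>
    continuous_iff_continuousAt.2 fun t => (hg n t).continuousAt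
  have hIoo : ∀ n, ∀ t ∈ Ioo 0 T, g n t = 0 := by
    intro n
    induction n with
    | zero => exact h0
    | succ n ih =>
      intro t ht
      have hz : g n =ᶠ[𝓝 t] fun _ => 0 := by
        filter_upwards [Ioo_mem_nhds ht.1 ht.2] with s hs using ih s hs
      have := (hg n t).unique ((hasDerivAt_const t (0 : E)).congr_of_eventuallyEq hz)
      exact (smul_eq_zero.1 this).resolve_left (by positivity)
  have hz0 : ∀ n, g n 0 = 0 := by
    intro n
    have hcl : IsClosed {t | g n t = 0} := isClosed_eq (hcont n) continuous_const
    have : closure (Ioo 0 T) ⊆ {t | g n t = 0} := closure_minimal (hIoo n) hcl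
    rw [closure_Ioo hT.ne] at this
    exact this (left_mem_Icc.2 hT.le)
  have hcl : IsClosed {t | ∀ n, g n t = 0} := by
    simp only [ofPred_forall]
    exact isClosed_iInter fun n => isClosed_eq (hcont n) continuous_const
  -- Continuous induction: the times at which all coefficients vanish form a closed set containing
  -- `0` and open to the right.
  have := IsClosed.Icc_subset_of_forall_mem_nhdsWithin (a := 0) (b := t)
    (hcl.inter isClosed_Icc) hz0 (fun s hs => by
      have : Ioo s (s + 1 / (2 * R)) ∈ 𝓝[>] s := Ioo_mem_nhdsGT (by simp [hR])
      filter_upwards [this] with r hr n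
      exact eq_zero_near_of_taylor hg hM hR (fun n t _ => hb n t) hs.1 hr.1.le hr.2 n)
  exact this (right_mem_Icc.2 ht) 0

end Taylor

/-! ### Taylor coefficients of solutions of a quadratic differential equation -/

section Quadratic

variable {X : Type*} [NormedCommRing X] [NormedAlgebra ℝ X] (K : X →L[ℝ] X)

/-- The Taylor coefficients at a time where it takes the value `x` of a solution of
`U' = K (U + U² / 2)`. -/
def taylorCoeff (x : X) : ℕ → X
  | 0 => x
  | n + 1 => ((n : ℝ) + 1)⁻¹ • K (taylorCoeff x n +
      (2⁻¹ : ℝ) • ∑ i : Fin (n + 1), taylorCoeff x i * taylorCoeff x (n - i))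
  termination_by n => n
  decreasing_by all_goals omega

lemma taylorCoeff_zero (x : X) : taylorCoeff K x 0 = x := by rw [taylorCoeff]

lemma taylorCoeff_succ (x : X) (n : ℕ) :
    ((n : ℝ) + 1) • taylorCoeff K x (n + 1) = K (taylorCoeff K x n + (2⁻¹ : ℝ) •
      ∑ p ∈ Finset.HasAntidiagonal.antidiagonal n, taylorCoeff K x p.1 * taylorCoeff K x p.2) := by
  rw [taylorCoeff, smul_inv_smul₀ (by positivity),
    Finset.Nat.sum_antidiagonal_eq_sum_range_succ
      (fun i j => taylorCoeff K x i * taylorCoeff K x j), Finset.sum_range]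

/-- Leibniz rule for the square of a power series: the two index weights of each product add up to
`n + 1`. -/
lemma sum_antidiagonal_deriv (a : ℕ → X) (n : ℕ) :
    ∑ p ∈ Finset.HasAntidiagonal.antidiagonal n, ((((p.1 : ℝ) + 1) • a (p.1 + 1)) * a p.2 +
      a p.1 * (((p.2 : ℝ) + 1) • a (p.2 + 1))) =
    ((n : ℝ) + 1) • ∑ p ∈ Finset.HasAntidiagonal.antidiagonal (n + 1), a p.1 * a p.2 := by
  have h1 : ∑ p ∈ Finset.HasAntidiagonal.antidiagonal n, (((p.1 : ℝ) + 1) • a (p.1 + 1)) * a p.2 =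
      ∑ p ∈ Finset.HasAntidiagonal.antidiagonal (n + 1), (p.1 : ℝ) • (a p.1 * a p.2) := by
    rw [Finset.Nat.sum_antidiagonal_succ]
    simp
  have h2 : ∑ p ∈ Finset.HasAntidiagonal.antidiagonal n, a p.1 * (((p.2 : ℝ) + 1) • a (p.2 + 1)) =
      ∑ p ∈ Finset.HasAntidiagonal.antidiagonal (n + 1), (p.2 : ℝ) • (a p.1 * a p.2) := by
    rw [Finset.Nat.sum_antidiagonal_succ']
    simp
  rw [Finset.sum_add_distrib, h1, h2, ← Finset.sum_add_distrib, Finset.smul_sum]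
  refine Finset.sum_congr rfl fun p hp => ?_
  rw [← add_smul]
  congr 1
  exact_mod_cast Finset.HasAntidiagonal.mem_antidiagonal.1 hp

/-- The Cauchy product has `n + 1` terms of equal bound, and the factor `(n + 1)⁻¹` of the recursion
absorbs this count, so the growth is geometric. -/
lemma norm_taylorCoeff_le {x : X} {M : ℝ} (hx : ‖x‖ ≤ M) (n : ℕ) :
    ‖taylorCoeff K x n‖ ≤ M * (‖K‖ * (1 + M)) ^ n := by
  have hM : 0 ≤ M := (norm_nonneg x).trans hx
  induction n using Nat.strong_induction_on with
  | _ n ih =>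
    rcases n with _ | n
    · simpa [taylorCoeff_zero] using hx
    · set R := ‖K‖ * (1 + M) with hR
      have hR0 : 0 ≤ R := by positivity
      have hs : ‖∑ p ∈ Finset.HasAntidiagonal.antidiagonal n, taylorCoeff K x p.1 * taylorCoeff K x p.2‖ ≤
          ((n : ℝ) + 1) * (M * M * R ^ n) := by
        refine (norm_sum_le_of_le (Finset.HasAntidiagonal.antidiagonal n) (f := fun p => taylorCoeff K x p.1 *
          taylorCoeff K x p.2) (n := fun _ => M * M * R ^ n) fun p hp => ?_).trans ?_
        · have hp' := Finset.HasAntidiagonal.mem_antidiagonal.1 hp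
          calc _ ≤ ‖taylorCoeff K x p.1‖ * ‖taylorCoeff K x p.2‖ := norm_mul_le _ _
            _ ≤ (M * R ^ p.1) * (M * R ^ p.2) := by
              gcongr
              · exact ih _ (by omega)
              · exact ih _ (by omega)
            _ = M * M * R ^ n := by rw [← hp', pow_add]; ring
        · simp
      have h1 : ((n : ℝ) + 1) * ‖taylorCoeff K x (n + 1)‖ ≤
          ((n : ℝ) + 1) * (M * R ^ (n + 1)) := by
        rw [← Real.norm_of_nonneg (by positivity : (0 : ℝ) ≤ (n : ℝ) + 1), ← norm_smul,
          taylorCoeff_succ, Real.norm_of_nonneg (by positivity : (0 : ℝ) ≤ (n : ℝ) + 1)]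
        calc _ ≤ ‖K‖ * ‖taylorCoeff K x n + (2⁻¹ : ℝ) • ∑ p ∈ Finset.HasAntidiagonal.antidiagonal n,
                taylorCoeff K x p.1 * taylorCoeff K x p.2‖ := K.le_opNorm _
          _ ≤ ‖K‖ * (M * R ^ n + 2⁻¹ * (((n : ℝ) + 1) * (M * M * R ^ n))) := by
            gcongr
            refine (norm_add_le _ _).trans (add_le_add (ih n (by omega)) ?_)
            rw [norm_smul]
            gcongr
            norm_num
          _ ≤ ‖K‖ * (((n : ℝ) + 1) * (M * R ^ n) + ((n : ℝ) + 1) * (M * M * R ^ n)) := by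
            have h2 : 0 ≤ M * R ^ n := by positivity
            have h3 : 0 ≤ ((n : ℝ) + 1) * (M * M * R ^ n) := by positivity
            refine mul_le_mul_of_nonneg_left (add_le_add ?_ (by linarith)) (norm_nonneg K)
            exact le_mul_of_one_le_left h2 (by simp)
          _ = _ := by rw [pow_succ, hR]; ring
      exact le_of_mul_le_mul_left h1 (by positivity)

lemma hasDerivAt_taylorCoeff {U : ℝ → X}
    (hU : ∀ t, HasDerivAt U (K (U t + (2⁻¹ : ℝ) • (U t * U t))) t) (n : ℕ) (t : ℝ) :
    HasDerivAt (fun s => taylorCoeff K (U s) n)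
      (((n : ℝ) + 1) • taylorCoeff K (U t) (n + 1)) t := by
  induction n using Nat.strong_induction_on with
  | _ n ih =>
    rcases n with _ | n
    · rw [taylorCoeff_succ]
      simpa [taylorCoeff_zero] using hU t
    · have hfun : (fun s => taylorCoeff K (U s) (n + 1)) = fun s => ((n : ℝ) + 1)⁻¹ •
          K (taylorCoeff K (U s) n + (2⁻¹ : ℝ) • ∑ p ∈ Finset.HasAntidiagonal.antidiagonal n,
            taylorCoeff K (U s) p.1 * taylorCoeff K (U s) p.2) := by
        funext s
        rw [← taylorCoeff_succ, inv_smul_smul₀ (by positivity)]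
      have hsum : HasDerivAt (fun s => ∑ p ∈ Finset.HasAntidiagonal.antidiagonal n,
          taylorCoeff K (U s) p.1 * taylorCoeff K (U s) p.2)
          (((n : ℝ) + 1) • ∑ p ∈ Finset.HasAntidiagonal.antidiagonal (n + 1),
            taylorCoeff K (U t) p.1 * taylorCoeff K (U t) p.2) t := by
        rw [← sum_antidiagonal_deriv]
        refine HasDerivAt.fun_sum fun p hp => ?_
        have hp' := Finset.HasAntidiagonal.mem_antidiagonal.1 hp
        exact (ih p.1 (by omega)).mul (ih p.2 (by omega))
      have h := (K.hasFDerivAt.comp_hasDerivAt t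
        ((ih n (by omega)).add (hsum.const_smul (2⁻¹ : ℝ)))).const_smul ((n : ℝ) + 1)⁻¹
      rw [hfun, taylorCoeff_succ]
      convert! h using 1
      rw [smul_comm (2⁻¹ : ℝ), ← smul_add, map_smul, inv_smul_smul₀ (by positivity)]

end Quadratic

/-! ### The lemma of du Bois-Reymond -/

section DuBoisReymond

/-- A difference of translates of a primitive of a test function `φ` is again a test function; its
derivative tests `H` against its own translate. -/
lemma eq_translate_of_integral_deriv_mul_eq_zero {H : ℝ → ℝ} (hH : Continuous H)
    (h : ∀ θ : ℝ → ℝ, ContDiff ℝ ∞ θ → HasCompactSupport θ → ∫ t, deriv θ t * H t = 0) (a : ℝ) :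
    ∀ t, H t = H (t + a) := by
  have hcH : Continuous fun t => H t - H (t + a) := by fun_prop
  have hae : ∀ᵐ t, H t - H (t + a) = 0 := by
    refine ae_eq_zero_of_integral_contDiff_smul_eq_zero hcH.locallyIntegrable fun φ hφ hφc => ?_
    have hφ0 : Continuous φ := hφ.continuous
    set Φ : ℝ → ℝ := fun t => ∫ s in (0 : ℝ)..t, φ s with hΦ
    have hΦd : ∀ t, HasDerivAt Φ (φ t) t := fun t =>
      hφ0.integral_hasStrictDerivAt 0 t |>.hasDerivAt
    have hΦc : ContDiff ℝ ∞ Φ := by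
      rw [contDiff_infty_iff_deriv]
      refine ⟨fun t => (hΦd t).differentiableAt, ?_⟩
      rw [show deriv Φ = φ from funext fun t => (hΦd t).deriv]
      exact hφ
    set θ : ℝ → ℝ := fun t => Φ t - Φ (t - a) with hθ
    have hθd : deriv θ = fun t => φ t - φ (t - a) := by
      funext t
      exact ((hΦd t).sub ((hΦd (t - a)).comp_sub_const t a)).deriv
    have hθc : ContDiff ℝ ∞ θ := hΦc.sub (hΦc.comp (contDiff_id.sub contDiff_const))
    obtain ⟨B, hB⟩ := hφc.isCompact.isBounded.subset_closedBall (0 : ℝ)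
    have hφz : ∀ t, B < |t| → φ t = 0 := by
      intro t ht
      by_contra hne
      have := hB (subset_tsupport φ hne)
      rw [mem_closedBall_zero_iff, Real.norm_eq_abs] at this
      linarith
    have hθs : HasCompactSupport θ := by
      refine HasCompactSupport.intro (isCompact_closedBall (0 : ℝ) (|B| + |a|)) fun t ht => ?_
      rw [mem_closedBall_zero_iff, Real.norm_eq_abs, not_le] at ht
      -- The window from `t - a` to `t` misses the support of `φ` once `|t|` exceeds `|B| + |a|`.
      have : θ t = ∫ s in (t - a)..t, φ s := by
        simp only [hθ, hΦ]
        rw [intervalIntegral.integral_interval_sub_left] <;> exact hφ0.intervalIntegrable _ _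
      rw [this]
      refine intervalIntegral.integral_zero_ae (ae_of_all _ fun s hs => hφz s ?_)
      have h1 : |s - t| ≤ |a| := by
        rcases le_total 0 a with h | h
        · rw [uIoc_of_le (by linarith)] at hs
          rw [abs_le, abs_of_nonneg h]
          constructor <;> linarith [hs.1, hs.2]
        · rw [uIoc_of_ge (by linarith)] at hs
          rw [abs_le, abs_of_nonpos h]
          constructor <;> linarith [hs.1, hs.2]
      have h2 : |t| ≤ |s| + |s - t| := by
        have := abs_sub_abs_le_abs_sub t s
        rw [abs_sub_comm t s] at this
        linarith
      linarith [le_abs_self B]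
    have key := h θ hθc hθs
    rw [hθd] at key
    have hi1 : Integrable fun t => φ t * H t :=
      (hφ0.mul hH).integrable_of_hasCompactSupport hφc.mul_right
    have hi2 : Integrable fun t => φ t * H (t + a) :=
      (hφ0.mul (hH.comp (continuous_id.add continuous_const))).integrable_of_hasCompactSupport
        hφc.mul_right
    have hi3 : Integrable fun t => φ (t - a) * H t := by
      simpa using hi2.comp_sub_right a
    have h3 : ∫ t, φ (t - a) * H t = ∫ t, φ t * H (t + a) := by
      rw [← integral_sub_right_eq_self (fun t => φ t * H (t + a)) a]
      simp
    simp only [sub_mul] at key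
    rw [integral_sub hi1 hi3, h3] at key
    simp only [smul_eq_mul, mul_sub]
    rw [integral_sub hi1 hi2, key]
  have := Continuous.ae_eq_iff_eq (μ := volume) hcH (continuous_const (y := (0 : ℝ))) |>.1 hae
  intro t
  linarith [congrFun this t]

/-- By parts, `F` minus a primitive of `G` has zero weak derivative, hence is constant. -/
lemma hasDerivAt_of_integral_deriv_mul_add {F G : ℝ → ℝ} (hF : Continuous F) (hG : Continuous G)
    (h : ∀ θ : ℝ → ℝ, ContDiff ℝ ∞ θ → HasCompactSupport θ →
      ∫ t, (deriv θ t * F t + θ t * G t) = 0) (t : ℝ) : HasDerivAt F (G t) t := by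
  set J : ℝ → ℝ := fun t => ∫ s in (0 : ℝ)..t, G s with hJ
  have hJd : ∀ t, HasDerivAt J (G t) t := fun t =>
    hG.integral_hasStrictDerivAt 0 t |>.hasDerivAt
  have hJc : Continuous J := continuous_iff_continuousAt.2 fun t => (hJd t).continuousAt
  have hconst := fun a => eq_translate_of_integral_deriv_mul_eq_zero (hF.sub hJc)
    (fun θ hθ hθc => by
      have hθd : Continuous (deriv θ) := hθ.continuous_deriv (by simp)
      have i1 : Integrable fun t => deriv θ t * F t :=
        (hθd.mul hF).integrable_of_hasCompactSupport hθc.deriv.mul_right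
      have i2 : Integrable fun t => θ t * G t :=
        (hθ.continuous.mul hG).integrable_of_hasCompactSupport hθc.mul_right
      have i3 : Integrable fun t => deriv θ t * J t :=
        (hθd.mul hJc).integrable_of_hasCompactSupport hθc.deriv.mul_right
      have i4 : Integrable fun t => θ t * J t :=
        (hθ.continuous.mul hJc).integrable_of_hasCompactSupport hθc.mul_right
      have hparts := integral_mul_deriv_eq_deriv_mul_of_integrable
        (fun t _ => (hθ.differentiable (by simp) t).hasDerivAt) (fun t _ => hJd t) i2 i3 i4
      have h0 := h θ hθ hθc
      rw [integral_add i1 i2, hparts] at h0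
      simp only [Pi.sub_apply, mul_sub]
      rw [integral_sub i1 i3]
      linarith) a 0
  have hFJ : F = fun t => J t + (F 0 - J 0) := by
    funext s
    have := hconst s
    simp only [Pi.sub_apply, zero_add] at this
    linarith
  rw [hFJ]
  exact (hJd t).add_const _

end DuBoisReymond

/-! ### Fourier series of continuous functions on the torus -/

/-- The Cauchy-Schwarz inequality for series. -/
lemma summable_mul_and_tsum_mul_le {ι : Type*} {f g : ι → ℝ} (hf0 : ∀ i, 0 ≤ f i)
    (hg0 : ∀ i, 0 ≤ g i) (hf : Summable fun i => f i ^ 2) (hg : Summable fun i => g i ^ 2) :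
    Summable (fun i => f i * g i) ∧
      ∑' i, f i * g i ≤ √(∑' i, f i ^ 2) * √(∑' i, g i ^ 2) := by
  have h := Real.summable_and_inner_le_Lp_mul_Lq_tsum_of_nonneg
    (Real.HolderConjugate.two_two) hf0 hg0 (by simpa using hf) (by simpa using hg)
  refine ⟨h.1, ?_⟩
  have := h.2
  simpa [Real.sqrt_eq_rpow] using this

/-- The complex-valued continuous functions on the torus. -/
abbrev CTorus : Type := C(Torus, ℂ)

lemma norm_fourier (k : ℤ) : ‖(fourier k : CTorus)‖ = 1 := fourier_norm k

lemma integrable_haar (f : CTorus) : Integrable f AddCircle.haarAddCircle :=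
  f.continuous.integrable_of_hasCompactSupport
    (HasCompactSupport.of_compactSpace _)

/-- The mean value of a continuous function on the torus. -/
def avg : CTorus →L[ℂ] ℂ :=
  LinearMap.mkContinuous
    { toFun := fun f => ∫ x, f x ∂AddCircle.haarAddCircle
      map_add' := fun f g => by
        simpa using integral_add (integrable_haar f) (integrable_haar g)
      map_smul' := fun c f => by
        simpa using integral_const_mul c (f : Torus → ℂ) } 1 fun f => by
    refine (norm_integral_le_of_norm_le_const (ae_of_all _ fun x => f.norm_coe_le_norm x)).trans ?_
    simp

lemma avg_apply (f : CTorus) : avg f = ∫ x, f x ∂AddCircle.haarAddCircle := rfl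

/-- The `k`-th Fourier coefficient, as a continuous linear functional. -/
def fhat (k : ℤ) : CTorus →L[ℂ] ℂ := avg ∘L (ContinuousLinearMap.mul ℂ CTorus (fourier (-k)))

lemma fhat_apply (k : ℤ) (f : CTorus) : fhat k f = avg (fourier (-k) * f) := rfl

lemma fhat_eq (k : ℤ) (f : CTorus) : fhat k f = fourierCoeff f k := rfl

lemma fhat_fourier (j k : ℤ) : fhat k (fourier j) = if k = j then 1 else 0 := by
  rw [fhat_eq, fourierCoeff_fourier, Pi.single_apply]

lemma hasSum_sq_fhat (f : CTorus) :
    HasSum (fun k => ‖fhat k f‖ ^ 2) (∫ x, ‖f x‖ ^ 2 ∂AddCircle.haarAddCircle) := by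
  have h := hasSum_sq_fourierCoeff (ContinuousMap.toLp (E := ℂ) 2 AddCircle.haarAddCircle ℂ f)
  simp_rw [fourierCoeff_toLp] at h
  convert! h using 1
  refine integral_congr_ae ?_
  filter_upwards [ContinuousMap.coeFn_toLp (E := ℂ) (p := 2) (𝕜 := ℂ)
    (AddCircle.haarAddCircle (T := 2 * Real.pi)) f] with x hx
  rw [hx]

lemma summable_sq_fhat (f : CTorus) : Summable fun k => ‖fhat k f‖ ^ 2 := (hasSum_sq_fhat f).summable

lemma tsum_sq_fhat_le (f : CTorus) : ∑' k, ‖fhat k f‖ ^ 2 ≤ ‖f‖ ^ 2 := by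
  rw [(hasSum_sq_fhat f).tsum_eq]
  have := norm_integral_le_of_norm_le_const (μ := AddCircle.haarAddCircle (T := 2 * Real.pi))
    (f := fun x => ‖f x‖ ^ 2) (C := ‖f‖ ^ 2) (ae_of_all _ fun x => by
      rw [norm_pow, norm_norm]
      gcongr
      exact f.norm_coe_le_norm x)
  refine (le_abs_self _).trans (by simpa using this)

lemma fhat_ext {f g : CTorus} (h : ∀ k, fhat k f = fhat k g) : f = g := by
  have h0 : Summable (fourierCoeff (⇑(f - g))) := by
    have : fourierCoeff (⇑(f - g)) = fun _ => 0 := by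
      funext k
      rw [← fhat_eq, map_sub, h k, sub_self]
    rw [this]
    exact summable_zero
  have hs := hasSum_fourier_series_of_summable h0
  have : (fun k => fourierCoeff (⇑(f - g)) k • (fourier k : CTorus)) = fun _ => 0 := by
    funext k
    rw [← fhat_eq, map_sub, h k, sub_self, zero_smul]
  rw [this] at hs
  exact sub_eq_zero.1 (hs.unique hasSum_zero)

lemma summable_smul_fourier {a : ℤ → ℂ} (ha : Summable fun k => ‖a k‖) :
    Summable fun k => a k • (fourier k : CTorus) :=
  .of_norm <| by simpa [norm_smul, norm_fourier] using ha

lemma fhat_tsum {a : ℤ → ℂ} (ha : Summable fun k => ‖a k‖) (k : ℤ) :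
    fhat k (∑' j, a j • (fourier j : CTorus)) = a k := by
  rw [(fhat k).map_tsum (summable_smul_fourier ha), tsum_eq_single k]
  · simp [fhat_fourier]
  · intro j hj
    simp [fhat_fourier, hj.symm]

lemma norm_tsum_smul_fourier_le {a : ℤ → ℂ} (ha : Summable fun k => ‖a k‖) :
    ‖∑' j, a j • (fourier j : CTorus)‖ ≤ ∑' j, ‖a j‖ := by
  refine (norm_tsum_le_tsum_norm (by simpa [norm_smul, norm_fourier] using ha)).trans_eq ?_
  simp [norm_smul, norm_fourier]

/-! ### The operator `-∂ₓ (1 - ∂ₓ²)⁻¹` -/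

/-- The symbol `1 + k²` of `1 - ∂ₓ²`. -/
def weight (k : ℤ) : ℝ := 1 + (k : ℝ) ^ 2

lemma weight_pos (k : ℤ) : 0 < weight k := by unfold weight; positivity

lemma weight_neg (k : ℤ) : weight (-k) = weight k := by simp [weight]

lemma summable_inv_weight : Summable fun k => (weight k)⁻¹ := by
  have h := (Real.summable_one_div_int_pow (p := 2)).2 (by norm_num)
  refine Summable.of_norm_bounded_eventually h ?_
  have : ({0}ᶜ : Set ℤ) ∈ cofinite := (Set.finite_singleton (0 : ℤ)).compl_mem_cofinite
  filter_upwards [this] with k hk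
  have hk' : (0 : ℝ) < (k : ℝ) ^ 2 := by
    have : (k : ℝ) ≠ 0 := by exact_mod_cast hk
    positivity
  rw [norm_inv, Real.norm_of_nonneg (weight_pos k).le, one_div]
  gcongr
  simp [weight]

/-- The symbol of `-∂ₓ (1 - ∂ₓ²)⁻¹`. -/
def symb (k : ℤ) : ℂ := -(Complex.I * k) / weight k

lemma symb_neg (k : ℤ) : symb (-k) = -symb k := by
  simp [symb, weight_neg, neg_div]

lemma weight_mul_symb (k : ℤ) : (weight k : ℂ) * symb k = -(Complex.I * k) := by
  rw [symb, mul_div_cancel₀]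
  exact_mod_cast (weight_pos k).ne'

lemma norm_symb_sq_le (k : ℤ) : ‖symb k‖ ^ 2 ≤ (weight k)⁻¹ := by
  have hw := weight_pos k
  have h1 : ‖symb k‖ = |(k : ℝ)| / weight k := by
    simp [symb, abs_of_pos hw]
  rw [h1, div_pow, sq_abs, div_le_iff₀ (by positivity), sq, sq, inv_mul_cancel_left₀ hw.ne']
  unfold weight
  nlinarith

lemma summable_norm_symb_sq : Summable fun k => ‖symb k‖ ^ 2 :=
  summable_inv_weight.of_nonneg_of_le (fun _ => by positivity) norm_symb_sq_le

lemma summable_symb_mul (f : CTorus) : Summable fun k => ‖symb k * fhat k f‖ := by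
  simpa [norm_mul] using (summable_mul_and_tsum_mul_le (fun _ => norm_nonneg _)
    (fun _ => norm_nonneg _) summable_norm_symb_sq (summable_sq_fhat f)).1

/-- The operator `-∂ₓ (1 - ∂ₓ²)⁻¹` on continuous functions. -/
def smoothing : CTorus →L[ℂ] CTorus :=
  LinearMap.mkContinuous
    { toFun := fun f => ∑' k, (symb k * fhat k f) • (fourier k : CTorus)
      map_add' := fun f g => by
        rw [← (summable_smul_fourier (summable_symb_mul f)).tsum_add
          (summable_smul_fourier (summable_symb_mul g))]
        simp [mul_add, add_smul]
      map_smul' := fun c f => by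
        rw [RingHom.id_apply, ← tsum_const_smul'']
        simp only [map_smul, smul_eq_mul, smul_smul]
        congr! 3
        ring }
    -- Cauchy-Schwarz: the symbol is in `ℓ²`, and so are the coefficients of `f`, with `ℓ²` norm at
    -- most `‖f‖`.
    (√(∑' k, ‖symb k‖ ^ 2)) fun f => by
      refine (norm_tsum_smul_fourier_le (summable_symb_mul f)).trans ?_
      have h := (summable_mul_and_tsum_mul_le (fun _ => norm_nonneg _)
        (fun _ => norm_nonneg _) summable_norm_symb_sq (summable_sq_fhat f)).2
      simp only [norm_mul]
      refine h.trans ?_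
      gcongr
      exact Real.sqrt_le_iff.2 ⟨norm_nonneg f, tsum_sq_fhat_le f⟩

lemma smoothing_apply (f : CTorus) :
    smoothing f = ∑' k, (symb k * fhat k f) • (fourier k : CTorus) := rfl

lemma fhat_smoothing (k : ℤ) (f : CTorus) : fhat k (smoothing f) = symb k * fhat k f := by
  rw [smoothing_apply, fhat_tsum (summable_symb_mul f)]

/-- The symbol is odd, so `k ↦ -k` turns the Parseval series into its negative. -/
lemma avg_mul_smoothing (f : CTorus) : avg (f * smoothing f) = 0 := by
  have h1 : HasSum (fun k => symb k * fhat k f * fhat (-k) f) (avg (f * smoothing f)) := by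
    have h := (avg ∘L ContinuousLinearMap.mul ℂ CTorus f).hasSum
      (summable_smul_fourier (summable_symb_mul f)).hasSum
    convert! h using 1
    funext k
    simp [fhat_apply, mul_comm f]
  have h2 : HasSum (fun k => -(symb k * fhat k f * fhat (-k) f)) (avg (f * smoothing f)) := by
    convert! (Equiv.neg ℤ).hasSum_iff.2 h1 using 1
    funext k
    simp only [Function.comp, Equiv.neg_apply, symb_neg, neg_neg]
    ring
  have := h2.unique h1.neg
  linear_combination (1 / 2 : ℂ) * this

/-! ### Trigonometric polynomials -/

/-- The trigonometric polynomial with coefficients `a k`, `k ∈ s`. -/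
def trig (s : Finset ℤ) (a : ℤ → ℂ) : CTorus := ∑ k ∈ s, a k • (fourier k : CTorus)

lemma hasDerivAt_trig (s : Finset ℤ) (a : ℤ → ℂ) (x : ℝ) :
    HasDerivAt (fun y : ℝ => trig s a (y : Torus))
      (trig s (fun k => Complex.I * k * a k) (x : Torus)) x := by
  simp only [trig, ContinuousMap.coe_sum, Finset.sum_apply, ContinuousMap.coe_smul, Pi.smul_apply]
  refine HasDerivAt.fun_sum fun k _ => ?_
  convert! (hasDerivAt_fourier (2 * Real.pi) k x).const_smul (a k) using 1
  have : (Real.pi : ℂ) ≠ 0 := by exact_mod_cast Real.pi_ne_zero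
  push_cast
  simp only [smul_eq_mul]
  field_simp

lemma avg_eq_intervalIntegral (f : CTorus) :
    avg f = (1 / (2 * Real.pi)) • ∫ x in (0 : ℝ)..(2 * Real.pi), f (x : Torus) := by
  have h := fourierCoeff_eq_intervalIntegral (T := 2 * Real.pi) f 0 0
  rw [← fhat_eq, fhat_apply] at h
  have h1 : (fourier (-0) * f : CTorus) = f := by ext x; simp
  rw [h1] at h
  simpa using h

/-- The integrand is the derivative of `p³ / 3` for the periodic `p = trig s a`. -/
lemma avg_trig_deriv (s : Finset ℤ) (a : ℤ → ℂ) :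
    avg (trig s (fun k => Complex.I * k * a k) * (trig s a * trig s a)) = 0 := by
  rw [avg_eq_intervalIntegral]
  have h : ∫ x in (0 : ℝ)..(2 * Real.pi),
      (trig s (fun k => Complex.I * k * a k) * (trig s a * trig s a)) (x : Torus) =
      (trig s a ((2 * Real.pi : ℝ) : Torus)) ^ 3 / 3 - (trig s a ((0 : ℝ) : Torus)) ^ 3 / 3 := by
    refine intervalIntegral.integral_eq_sub_of_hasDerivAt
      (f := fun x : ℝ => (trig s a (x : Torus)) ^ 3 / 3) (fun x _ => ?_) ?_
    · convert! ((hasDerivAt_trig s a x).pow 3).div_const 3 using 1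
      simp only [ContinuousMap.mul_apply]
      norm_num
      ring
    · exact ((ContinuousMap.continuous _).comp
        (AddCircle.continuous_mk' _)).intervalIntegrable _ _
  rw [h, AddCircle.coe_period]
  simp

lemma avg_trig_mul (s : Finset ℤ) (a : ℤ → ℂ) (f : CTorus) :
    avg (trig s a * f) = ∑ k ∈ s, a k * fhat (-k) f := by
  simp [trig, Finset.sum_mul, fhat_apply]

/-! ### Functions with square summable derivative -/

/-- `f` has Sobolev `H¹` norm at most `A`, up to normalization. -/
def SobolevBound (A : ℝ) (f : CTorus) : Prop :=
  Summable (fun k => weight k * ‖fhat k f‖ ^ 2) ∧ ∑' k, weight k * ‖fhat k f‖ ^ 2 ≤ A ^ 2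

/-- The embedding constant of the frequencies outside `s`. -/
def tailConst (s : Finset ℤ) : ℝ := √(∑' k : {k // k ∉ s}, (weight k)⁻¹)

lemma tailConst_nonneg (s : Finset ℤ) : 0 ≤ tailConst s := Real.sqrt_nonneg _

lemma tailConst_le (s : Finset ℤ) : tailConst s ≤ tailConst ∅ := by
  have h : ∀ s : Finset ℤ, ∑' k : {k // k ∉ s}, (weight k)⁻¹ ≤ ∑' k, (weight k)⁻¹ := fun s =>
    summable_inv_weight.tsum_subtype_le _ {k | k ∉ s} (fun k => (inv_pos.2 (weight_pos k)).le)
  refine Real.sqrt_le_sqrt ((h s).trans_eq ?_)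
  simpa using (summable_inv_weight.sum_add_tsum_subtype_compl ∅).symm

lemma tendsto_tailConst : Tendsto tailConst atTop (𝓝 0) := by
  have := (tendsto_tsum_compl_atTop_zero fun k => (weight k)⁻¹).sqrt
  rw [Real.sqrt_zero] at this
  exact this

lemma weighted_cauchy_schwarz {ι : Type*} {w b : ι → ℝ} (hw : ∀ i, 0 < w i) (hb : ∀ i, 0 ≤ b i)
    (h1 : Summable fun i => (w i)⁻¹) (h2 : Summable fun i => w i * b i ^ 2) :
    Summable b ∧ ∑' i, b i ≤ √(∑' i, (w i)⁻¹) * √(∑' i, w i * b i ^ 2) := by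
  have e1 : ∀ i, (√(w i)⁻¹) ^ 2 = (w i)⁻¹ := fun i => Real.sq_sqrt (inv_pos.2 (hw i)).le
  have e2 : ∀ i, (√(w i) * b i) ^ 2 = w i * b i ^ 2 := fun i => by
    rw [mul_pow, Real.sq_sqrt (hw i).le]
  have e3 : ∀ i, √(w i)⁻¹ * (√(w i) * b i) = b i := fun i => by
    rw [Real.sqrt_inv, inv_mul_cancel_left₀ (Real.sqrt_pos.2 (hw i)).ne']
  have h := summable_mul_and_tsum_mul_le (f := fun i => √(w i)⁻¹) (g := fun i => √(w i) * b i)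
    (fun i => Real.sqrt_nonneg _) (fun i => mul_nonneg (Real.sqrt_nonneg _) (hb i))
    (by simpa only [e1] using h1) (by simpa only [e2] using h2)
  simpa only [e1, e2, e3] using h

section Sobolev

variable {A : ℝ} {f : CTorus}

lemma SobolevBound.summable_norm (h : SobolevBound A f) : Summable fun k => ‖fhat k f‖ :=
  (weighted_cauchy_schwarz weight_pos (fun _ => norm_nonneg _) summable_inv_weight h.1).1

lemma SobolevBound.norm_sub_trig_le (h : SobolevBound A f) (hA : 0 ≤ A) (s : Finset ℤ) :
    ‖f - trig s (fun k => fhat k f)‖ ≤ tailConst s * A := by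
  have hs : HasSum (fun k => fhat k f • (fourier k : CTorus)) f :=
    hasSum_fourier_series_of_summable h.summable_norm.of_norm
  have hs' : HasSum (fun k : {k // k ∉ s} => fhat k f • (fourier k : CTorus))
      (f - trig s (fun k => fhat k f)) := by
    refine (s.hasSum_compl_iff (f := fun k => fhat k f • (fourier k : CTorus))).2 ?_
    simpa [trig] using hs
  have hsub : Function.Injective (fun k : {k // k ∉ s} => (k : ℤ)) := Subtype.val_injective
  have hw := weighted_cauchy_schwarz (ι := {k // k ∉ s}) (w := fun k => weight k)
    (b := fun k => ‖fhat k f‖) (fun k => weight_pos k) (fun _ => norm_nonneg _)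
    (summable_inv_weight.comp_injective hsub) (h.1.comp_injective hsub)
  rw [← hs'.tsum_eq]
  refine (norm_tsum_le_tsum_norm (by simpa [norm_smul, norm_fourier] using hw.1)).trans ?_
  simp only [norm_smul, norm_fourier, mul_one]
  refine hw.2.trans ?_
  unfold tailConst
  gcongr
  refine Real.sqrt_le_iff.2 ⟨hA, le_trans ?_ h.2⟩
  exact h.1.tsum_subtype_le _ {k | k ∉ s}
    (fun k => mul_nonneg (weight_pos k).le (sq_nonneg _))

lemma SobolevBound.norm_le (h : SobolevBound A f) (hA : 0 ≤ A) : ‖f‖ ≤ tailConst ∅ * A := by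
  simpa [trig] using h.norm_sub_trig_le hA ∅

/-- The sum is the mean of `p' f²`, with `p` the truncation of `f`. As `∫ p' p² = 0`, one may
replace `f²` by `f² - p² = (f - p)(f + p)`, which is uniformly small with the tail. This controls
the flux of the truncated energy using `H¹` regularity alone. -/
lemma SobolevBound.norm_sum_le (h : SobolevBound A f) (hA : 0 ≤ A) (s : Finset ℤ) :
    ‖∑ k ∈ s, Complex.I * k * fhat k f * fhat (-k) (f * f)‖ ≤
      3 * tailConst ∅ * tailConst s * A ^ 3 := by
  set p := trig s (fun k => fhat k f) with hp
  set q := trig s (fun k => Complex.I * k * fhat k f) with hq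
  set r := f * f - p * p with hr
  have hr' : r = (f - p) * (f + p) := by rw [hr]; ring
  have h1 : ∑ k ∈ s, Complex.I * k * fhat k f * fhat (-k) (f * f) =
      ∑ k ∈ s, Complex.I * k * fhat k f * fhat (-k) r := by
    rw [← avg_trig_mul, ← avg_trig_mul, hr, mul_sub, map_sub, avg_trig_deriv, sub_zero]
  have hS := tailConst_nonneg ∅
  have hT := tailConst_nonneg s
  have hfp := h.norm_sub_trig_le hA s
  have hf := h.norm_le hA
  have hpn : ‖p‖ ≤ 2 * (tailConst ∅ * A) := by
    have h2 : ‖p‖ ≤ ‖f‖ + ‖f - p‖ := by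
      have := norm_sub_le f (f - p)
      simpa using this
    have h3 : tailConst s * A ≤ tailConst ∅ * A := by gcongr; exact tailConst_le s
    linarith
  have hrn : ‖r‖ ≤ 3 * tailConst ∅ * tailConst s * A ^ 2 := by
    rw [hr']
    calc ‖(f - p) * (f + p)‖ ≤ ‖f - p‖ * ‖f + p‖ := norm_mul_le _ _
      _ ≤ (tailConst s * A) * (tailConst ∅ * A + 2 * (tailConst ∅ * A)) := by
        gcongr
        exact (norm_add_le _ _).trans (add_le_add hf hpn)
      _ = _ := by ring
  rw [h1]
  calc ‖∑ k ∈ s, Complex.I * k * fhat k f * fhat (-k) r‖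
      ≤ ∑ k ∈ s, (|(k : ℝ)| * ‖fhat k f‖) * ‖fhat (-k) r‖ := by
        refine norm_sum_le_of_le _ fun k _ => ?_
        simp
    _ ≤ √(∑ k ∈ s, (|(k : ℝ)| * ‖fhat k f‖) ^ 2) * √(∑ k ∈ s, ‖fhat (-k) r‖ ^ 2) :=
        Real.sum_mul_le_sqrt_mul_sqrt _ _ _
    _ ≤ A * ‖r‖ := by
        gcongr
        · refine Real.sqrt_le_iff.2 ⟨hA, le_trans ?_ h.2⟩
          refine le_trans (Finset.sum_le_sum fun k _ => ?_) (h.1.sum_le_tsum s fun k _ =>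
            mul_nonneg (weight_pos k).le (sq_nonneg _))
          rw [mul_pow, sq_abs]
          gcongr
          simp [weight]
        · refine Real.sqrt_le_iff.2 ⟨norm_nonneg r, le_trans ?_ (tsum_sq_fhat_le r)⟩
          have := ((Equiv.neg ℤ).summable_iff.2 (summable_sq_fhat r)).sum_le_tsum s
            fun k _ => by simp
          rw [← (Equiv.neg ℤ).tsum_eq]
          exact this
    _ ≤ A * (3 * tailConst ∅ * tailConst s * A ^ 2) := by gcongr
    _ = _ := by ring

end Sobolev

/-! ### Continuous representatives of Sobolev functions -/

lemma hs_weight (k : ℤ) : (1 + (k : ℝ) ^ 2) ^ (1 : ℝ) = weight k := Real.rpow_one _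

lemma MemHs.summable_weight {f : Torus → ℝ} (h : MemHs 1 f) :
    Summable fun k => weight k * ‖coeff f k‖ ^ 2 := by
  simpa only [hs_weight] using h.2

lemma MemHs.summable_norm_coeff {f : Torus → ℝ} (h : MemHs 1 f) :
    Summable fun k => ‖coeff f k‖ :=
  (weighted_cauchy_schwarz weight_pos (fun _ => norm_nonneg _) summable_inv_weight
    h.summable_weight).1

/-- The sum of the Fourier series of `f`. -/
def rep (f : Torus → ℝ) : CTorus := ∑' k, coeff f k • (fourier k : CTorus)

lemma MemHs.fhat_rep {f : Torus → ℝ} (h : MemHs 1 f) (k : ℤ) : fhat k (rep f) = coeff f k :=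
  fhat_tsum h.summable_norm_coeff k

lemma MemHs.memLp_haar {f : Torus → ℝ} (h : MemHs 1 f) :
    MemLp (fun x => (f x : ℂ)) 2 (AddCircle.haarAddCircle (T := 2 * Real.pi)) :=
  memLp_haarAddCircle_iff.2 h.1.ofReal

lemma ae_volume_iff_ae_haar {p : Torus → Prop} :
    (∀ᵐ x, p x) ↔ ∀ᵐ x ∂(AddCircle.haarAddCircle (T := 2 * Real.pi)), p x := by
  rw [AddCircle.volume_eq_smul_haarAddCircle, Measure.ae_ennreal_smul_measure_iff]
  simpa using Real.pi_pos

/-- Both sides have the same Fourier coefficients in `L²`. -/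
lemma MemHs.rep_ae_eq {f : Torus → ℝ} (h : MemHs 1 f) : ∀ᵐ x, rep f x = (f x : ℂ) := by
  rw [ae_volume_iff_ae_haar]
  have key : ContinuousMap.toLp (E := ℂ) 2 AddCircle.haarAddCircle ℂ (rep f) =
      h.memLp_haar.toLp := by
    apply (fourierBasis (T := 2 * Real.pi)).repr.injective
    ext k
    rw [fourierBasis_repr, fourierBasis_repr, fourierCoeff_toLp, ← fhat_eq, h.fhat_rep,
      fourierCoeff_congr_ae h.memLp_haar.coeFn_toLp, coeff]
  filter_upwards [ContinuousMap.coeFn_toLp (E := ℂ) (p := 2) (𝕜 := ℂ)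
    (AddCircle.haarAddCircle (T := 2 * Real.pi)) (rep f), h.memLp_haar.coeFn_toLp] with x h1 h2
  rw [← h1, key, h2]

lemma eq_of_ae_eq {Y : Type*} [TopologicalSpace Y] [T2Space Y] {f g : Torus → Y}
    (hf : Continuous f) (hg : Continuous g) (h : ∀ᵐ x, f x = g x) : f = g :=
  (hf.ae_eq_iff_eq volume hg).1 h

lemma MemHs.rep_im {f : Torus → ℝ} (h : MemHs 1 f) (x : Torus) : (rep f x).im = 0 := by
  have := eq_of_ae_eq (Complex.continuous_im.comp (rep f).continuous)
    (continuous_const (y := (0 : ℝ))) (by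
      filter_upwards [h.rep_ae_eq] with x hx
      simp [hx])
  exact congrFun this x

lemma coeff_sub {f g : Torus → ℝ} (hf : MemHs 1 f) (hg : MemHs 1 g) (k : ℤ) :
    coeff (fun x => f x - g x) k = coeff f k - coeff g k := by
  have i1 := (hf.memLp_haar.integrable one_le_two).fourier_smul (-k)
  have i2 := (hg.memLp_haar.integrable one_le_two).fourier_smul (-k)
  simp only [coeff, fourierCoeff, Complex.ofReal_sub, smul_sub]
  exact integral_sub i1 i2

lemma summable_weight_sub {a b : ℤ → ℂ} (ha : Summable fun k => weight k * ‖a k‖ ^ 2)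
    (hb : Summable fun k => weight k * ‖b k‖ ^ 2) :
    Summable (fun k => weight k * ‖a k - b k‖ ^ 2) ∧
    ∑' k, weight k * ‖a k - b k‖ ^ 2 ≤
      2 * ∑' k, weight k * ‖a k‖ ^ 2 + 2 * ∑' k, weight k * ‖b k‖ ^ 2 := by
  have hle : ∀ k, weight k * ‖a k - b k‖ ^ 2 ≤
      2 * (weight k * ‖a k‖ ^ 2) + 2 * (weight k * ‖b k‖ ^ 2) := fun k => by
    have h1 : ‖a k - b k‖ ^ 2 ≤ (‖a k‖ + ‖b k‖) ^ 2 := by gcongr; exact norm_sub_le _ _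
    have h2 : ‖a k - b k‖ ^ 2 ≤ 2 * ‖a k‖ ^ 2 + 2 * ‖b k‖ ^ 2 := by
      nlinarith [sq_nonneg (‖a k‖ - ‖b k‖)]
    have := mul_le_mul_of_nonneg_left h2 (weight_pos k).le
    linarith
  have hs := (ha.mul_left 2).add (hb.mul_left 2)
  have h0 : Summable (fun k => weight k * ‖a k - b k‖ ^ 2) :=
    hs.of_nonneg_of_le (fun k => mul_nonneg (weight_pos k).le (sq_nonneg _)) hle
  refine ⟨h0, (h0.tsum_le_tsum hle hs).trans_eq ?_⟩
  rw [(ha.mul_left 2).tsum_add (hb.mul_left 2), tsum_mul_left, tsum_mul_left]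

lemma SobolevBound.sub {A B : ℝ} {f g : CTorus} (hf : SobolevBound A f) (hg : SobolevBound B g)
    (hA : 0 ≤ A) (hB : 0 ≤ B) : SobolevBound (2 * (A + B)) (f - g) := by
  have h := summable_weight_sub hf.1 hg.1
  refine ⟨by simpa using h.1, ?_⟩
  simp only [map_sub]
  have := hf.2
  have := hg.2
  nlinarith [h.2, mul_nonneg hA hB]

lemma MemHs.sobolevBound_sub {f g : Torus → ℝ} (hf : MemHs 1 f) (hg : MemHs 1 g) :
    SobolevBound (hsNorm 1 (fun x => f x - g x)) (rep f - rep g) := by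
  have h := summable_weight_sub hf.summable_weight hg.summable_weight
  have h0 : 0 ≤ ∑' k, weight k * ‖coeff f k - coeff g k‖ ^ 2 :=
    tsum_nonneg fun k => mul_nonneg (weight_pos k).le (sq_nonneg _)
  simp only [SobolevBound, map_sub, hf.fhat_rep, hg.fhat_rep, hsNorm, hs_weight, coeff_sub hf hg]
  refine ⟨h.1, ?_⟩
  rw [Real.sq_sqrt (by positivity)]
  -- The squared `hsNorm` carries an extra factor `2π ≥ 1`.
  exact le_mul_of_one_le_left h0 (by linarith [Real.pi_gt_three])

lemma MemHs.exists_sobolevBound {f : Torus → ℝ} (hf : MemHs 1 f) :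
    ∃ A, 0 ≤ A ∧ SobolevBound A (rep f) := by
  refine ⟨√(∑' k, weight k * ‖coeff f k‖ ^ 2), Real.sqrt_nonneg _, ?_⟩
  simp only [SobolevBound, hf.fhat_rep]
  refine ⟨hf.summable_weight, ?_⟩
  rw [Real.sq_sqrt (tsum_nonneg fun k => mul_nonneg (weight_pos k).le (sq_nonneg _))]

lemma SobolevBound.mono {A B : ℝ} {f : CTorus} (h : SobolevBound A f) (hA : 0 ≤ A) (hAB : A ≤ B) :
    SobolevBound B f := ⟨h.1, h.2.trans (by gcongr)⟩

lemma continuous_rep {u : ℝ → Torus → ℝ} (hu : ContinuousInHs 1 u) :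
    Continuous fun t => rep (u t) := by
  refine continuous_iff_continuousAt.2 fun t₀ => ?_
  rw [ContinuousAt, tendsto_iff_norm_sub_tendsto_zero]
  refine squeeze_zero (fun _ => norm_nonneg _) (fun t =>
    ((hu.1 t).sobolevBound_sub (hu.1 t₀)).norm_le (Real.sqrt_nonneg _)) ?_
  simpa using (hu.2 t₀).const_mul (tailConst ∅)

/-- Continuity in `H¹` bounds the norm near each time; compactness of the interval does the rest. -/
lemma exists_sobolevBound_Icc {u : ℝ → Torus → ℝ} (hu : ContinuousInHs 1 u) (a b : ℝ) :
    ∃ A, 0 ≤ A ∧ ∀ t ∈ Icc a b, SobolevBound A (rep (u t)) := by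
  refine isCompact_Icc.induction_on
    (p := fun s : Set ℝ => ∃ A, 0 ≤ A ∧ ∀ t ∈ s, SobolevBound A (rep (u t)))
    ⟨0, le_rfl, by simp⟩ (fun s t hst ⟨A, hA, h⟩ => ⟨A, hA, fun r hr => h r (hst hr)⟩)
    (fun s t ⟨A, hA, h⟩ ⟨B, hB, h'⟩ => ⟨max A B, le_max_of_le_left hA, fun r hr => ?_⟩)
    (fun t₀ _ => ?_)
  · rcases hr with hr | hr
    · exact (h r hr).mono hA (le_max_left _ _)
    · exact (h' r hr).mono hB (le_max_right _ _)
  · obtain ⟨A, hA, h⟩ := (hu.1 t₀).exists_sobolevBound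
    have hev : ∀ᶠ t in 𝓝 t₀, hsNorm 1 (fun x => u t x - u t₀ x) < 1 :=
      (hu.2 t₀).eventually_lt_const one_pos
    -- The constant comes from `SobolevBound.sub` used twice, on `(rep (u t) - rep (u t₀)) - (0 -
    -- rep (u t₀))`.
    refine ⟨_, mem_nhdsWithin_of_mem_nhds hev, 2 * (1 + 2 * (0 + A)), by positivity,
      fun t ht => ?_⟩
    have h0 : SobolevBound 0 (0 : CTorus) := by simp [SobolevBound, summable_zero]
    have h1 := ((hu.1 t).sobolevBound_sub (hu.1 t₀)).mono (Real.sqrt_nonneg _)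
      (le_of_lt (by simpa using ht) : _ ≤ (1 : ℝ))
    have := h1.sub (h0.sub h le_rfl hA) zero_le_one (by positivity)
    simpa using this

/-! ### The equation in weak form -/

lemma intervalIntegral_congr_torus {f g : Torus → ℝ} (h : ∀ᵐ x, f x = g x) {φ : ℝ → ℝ → ℝ} :
    ∫ x in (0 : ℝ)..(2 * Real.pi), φ x (f (x : Torus)) =
      ∫ x in (0 : ℝ)..(2 * Real.pi), φ x (g (x : Torus)) := by
  have hmp := AddCircle.measurePreserving_mk (2 * Real.pi) 0
  have h1 := hmp.quasiMeasurePreserving.ae h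
  rw [zero_add] at h1
  refine intervalIntegral.integral_congr_ae_restrict ?_
  rw [uIoc_of_le (by positivity)]
  filter_upwards [h1] with x hx
  rw [hx]

lemma continuous_eval_coe {U : ℝ → CTorus} (hU : Continuous U) :
    Continuous fun p : ℝ × ℝ => U p.1 (p.2 : Torus) :=
  (hU.comp continuous_fst).eval ((AddCircle.continuous_mk' _).comp continuous_snd)

/-- Testing on products and applying du Bois-Reymond in time. It serves twice: with `cos kx`, `sin
kx` for the Fourier coefficients, and with the multiplier of the growth argument. -/
lemma SolvesBBMWeakly.hasDerivAt {u : ℝ → Torus → ℝ} (hu : SolvesBBMWeakly u) {U : ℝ → CTorus}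
    (hU : Continuous U) (hUu : ∀ t, ∀ᵐ x, U t x = (u t x : ℂ)) {ψ : ℝ → ℝ} (hψ : ContDiff ℝ ∞ ψ)
    (hper : Function.Periodic ψ (2 * Real.pi)) (t : ℝ) :
    HasDerivAt (fun t => ∫ x in (0 : ℝ)..(2 * Real.pi),
        (U t (x : Torus)).re * (ψ x - deriv (deriv ψ) x))
      (∫ x in (0 : ℝ)..(2 * Real.pi),
        ((U t (x : Torus)).re + (U t (x : Torus)).re ^ 2 / 2) * deriv ψ x) t := by
  have c0 : Continuous ψ := hψ.continuous
  have hψ1 : ContDiff ℝ ∞ (deriv ψ) := (contDiff_infty_iff_deriv.1 hψ).2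
  have c1 : Continuous (deriv ψ) := hψ1.continuous
  have c2 : Continuous (deriv (deriv ψ)) := (contDiff_infty_iff_deriv.1 hψ1).2.continuous
  have hev := Complex.continuous_re.comp (continuous_eval_coe hU)
  have hev1 : ∀ t, Continuous fun x : ℝ => (U t (x : Torus)).re := fun t =>
    hev.comp (Continuous.prodMk_right t)
  refine hasDerivAt_of_integral_deriv_mul_add (G := fun t => ∫ x in (0 : ℝ)..(2 * Real.pi),
    ((U t (x : Torus)).re + (U t (x : Torus)).re ^ 2 / 2) * deriv ψ x) ?_ ?_
    (fun θ hθ hθc => ?_) t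
  · refine intervalIntegral.continuous_parametric_intervalIntegral_of_continuous' ?_ _ _
    exact hev.mul ((c0.sub c2).comp continuous_snd)
  · refine intervalIntegral.continuous_parametric_intervalIntegral_of_continuous' ?_ _ _
    exact (hev.add ((hev.pow 2).div_const 2)).mul (c1.comp continuous_snd)
  · rw [← neg_eq_zero, ← integral_neg]
    refine Eq.trans ?_ (hu θ ψ hθ hθc hψ hper)
    refine integral_congr_ae (ae_of_all _ fun t => ?_)
    dsimp only
    have hre : ∀ᵐ x, u t x = (U t x).re := by
      filter_upwards [hUu t] with x hx
      simp [hx]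
    rw [intervalIntegral_congr_torus hre (φ := fun x v =>
      (v * (-(deriv θ t * ψ x) + deriv θ t * deriv (deriv ψ) x - θ t * deriv ψ x)
        - v ^ 2 / 2 * (θ t * deriv ψ x))), ← intervalIntegral.integral_const_mul,
      ← intervalIntegral.integral_const_mul, ← intervalIntegral.integral_add]
    · refine intervalIntegral.integral_neg.symm.trans ?_
      refine intervalIntegral.integral_congr fun x _ => ?_
      ring
    · exact (continuous_const.mul ((hev1 t).mul (c0.sub c2))).intervalIntegrable _ _
    · exact (continuous_const.mul (((hev1 t).add (((hev1 t).pow 2).div_const 2)).mul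
        c1)).intervalIntegrable _ _

/-! ### The equation as an ordinary differential equation -/

lemma fhat_eq_cos_sin (k : ℤ) {f : CTorus} (hf : ∀ x, (f x).im = 0) :
    fhat k f = (1 / (2 * Real.pi) : ℂ) *
      ((∫ x in (0 : ℝ)..(2 * Real.pi), (f (x : Torus)).re * Real.cos (k * x) : ℝ) -
      Complex.I * (∫ x in (0 : ℝ)..(2 * Real.pi), (f (x : Torus)).re * Real.sin (k * x) : ℝ)) := by
  have hc : Continuous fun x : ℝ => (f (x : Torus)).re :=
    Complex.continuous_re.comp (f.continuous.comp (AddCircle.continuous_mk' _))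
  rw [fhat_apply, avg_eq_intervalIntegral, ← intervalIntegral.integral_ofReal,
    ← intervalIntegral.integral_ofReal, ← intervalIntegral.integral_const_mul,
    ← intervalIntegral.integral_sub]
  · rw [Complex.real_smul]
    push_cast
    congr 1
    refine intervalIntegral.integral_congr fun x _ => ?_
    have hfx : f (x : Torus) = ((f (x : Torus)).re : ℂ) := by
      apply Complex.ext <;> simp [hf]
    have he : fourier (-k) (x : Torus) = Complex.exp ((-(k * x) : ℂ) * Complex.I) := by
      rw [fourier_coe_apply]
      congr 1
      have : (Real.pi : ℂ) ≠ 0 := by exact_mod_cast Real.pi_ne_zero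
      push_cast
      field_simp
    rw [Pi.mul_apply, he, Complex.exp_mul_I, Complex.cos_neg, Complex.sin_neg, hfx]
    simp only [Complex.ofReal_re]
    ring
  · refine Continuous.intervalIntegrable ?_ _ _
    fun_prop
  · refine Continuous.intervalIntegrable ?_ _ _
    fun_prop

/-- The nonlinearity `u + u² / 2`. -/
def flux (f : CTorus) : CTorus := f + (2⁻¹ : ℝ) • (f * f)

lemma flux_apply (f : CTorus) (x : Torus) : flux f x = f x + f x * f x / 2 := by
  simp [flux, div_eq_inv_mul]

lemma flux_re {f : CTorus} (hf : ∀ x, (f x).im = 0) (x : Torus) :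
    (flux f x).re = (f x).re + (f x).re ^ 2 / 2 := by
  simp [flux, hf]
  ring

lemma flux_im {f : CTorus} (hf : ∀ x, (f x).im = 0) (x : Torus) : (flux f x).im = 0 := by
  simp [flux, hf]

lemma continuous_flux : Continuous flux := by
  unfold flux
  fun_prop

/-- For `ψ = cos kx` or `sin kx`, `ψ - ψ'' = (1 + k²) ψ`; dividing by this weight produces the
symbol. -/
lemma hasDerivAt_fhat_of_weak {u : ℝ → Torus → ℝ} (hu : SolvesBBMWeakly u) {U : ℝ → CTorus}
    (hU : Continuous U) (hUu : ∀ t, ∀ᵐ x, U t x = (u t x : ℂ)) (him : ∀ t x, (U t x).im = 0)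
    (k : ℤ) (t : ℝ) :
    HasDerivAt (fun t => fhat k (U t)) (symb k * fhat k (flux (U t))) t := by
  have dcos : deriv (fun x : ℝ => Real.cos (k * x)) = fun x => -(k * Real.sin (k * x)) := by
    funext x
    have := ((hasDerivAt_id x).const_mul (k : ℝ)).cos.deriv
    simp only [id] at this
    rw [this]
    ring
  have dsin : deriv (fun x : ℝ => Real.sin (k * x)) = fun x => k * Real.cos (k * x) := by
    funext x
    have := ((hasDerivAt_id x).const_mul (k : ℝ)).sin.deriv
    simp only [id] at this
    rw [this]
    ring
  have pcos : Function.Periodic (fun x : ℝ => Real.cos (k * x)) (2 * Real.pi) := fun x => by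
    simp only [mul_add]
    exact Real.cos_add_int_mul_two_pi _ k
  have psin : Function.Periodic (fun x : ℝ => Real.sin (k * x)) (2 * Real.pi) := fun x => by
    simp only [mul_add]
    exact Real.sin_add_int_mul_two_pi _ k
  have h1 := hu.hasDerivAt hU hUu (ψ := fun x => Real.cos (k * x)) (by fun_prop) pcos t
  have h2 := hu.hasDerivAt hU hUu (ψ := fun x => Real.sin (k * x)) (by fun_prop) psin t
  have ddcos : deriv (fun x : ℝ => -(k * Real.sin (k * x))) =
      fun x => -(k * (k * Real.cos (k * x))) := by
    funext x
    rw [deriv.fun_neg, deriv_const_mul_field, dsin]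
  have ddsin : deriv (fun x : ℝ => k * Real.cos (k * x)) =
      fun x => k * -(k * Real.sin (k * x)) := by
    funext x
    rw [deriv_const_mul_field, dcos]
  rw [dcos, ddcos] at h1
  rw [dsin, ddsin] at h2
  have hw := (weight_pos k).ne'
  have e1 : ∀ t, ∫ x in (0 : ℝ)..(2 * Real.pi), (U t (x : Torus)).re *
      (Real.cos (k * x) - -(k * (k * Real.cos (k * x)))) =
      weight k * ∫ x in (0 : ℝ)..(2 * Real.pi), (U t (x : Torus)).re * Real.cos (k * x) :=
    fun t => by
      rw [← intervalIntegral.integral_const_mul]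
      refine intervalIntegral.integral_congr fun x _ => ?_
      simp only [weight]
      ring
  have e2 : ∀ t, ∫ x in (0 : ℝ)..(2 * Real.pi), (U t (x : Torus)).re *
      (Real.sin (k * x) - k * -(k * Real.sin (k * x))) =
      weight k * ∫ x in (0 : ℝ)..(2 * Real.pi), (U t (x : Torus)).re * Real.sin (k * x) :=
    fun t => by
      rw [← intervalIntegral.integral_const_mul]
      refine intervalIntegral.integral_congr fun x _ => ?_
      simp only [weight]
      ring
  have e3 : ∫ x in (0 : ℝ)..(2 * Real.pi), ((U t (x : Torus)).re + (U t (x : Torus)).re ^ 2 / 2) *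
      -(k * Real.sin (k * x)) =
      -k * ∫ x in (0 : ℝ)..(2 * Real.pi), (flux (U t) (x : Torus)).re * Real.sin (k * x) := by
    rw [← intervalIntegral.integral_const_mul]
    refine intervalIntegral.integral_congr fun x _ => ?_
    simp only [flux_re (him t)]
    ring
  have e4 : ∫ x in (0 : ℝ)..(2 * Real.pi), ((U t (x : Torus)).re + (U t (x : Torus)).re ^ 2 / 2) *
      (k * Real.cos (k * x)) =
      k * ∫ x in (0 : ℝ)..(2 * Real.pi), (flux (U t) (x : Torus)).re * Real.cos (k * x) := by
    rw [← intervalIntegral.integral_const_mul]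
    refine intervalIntegral.integral_congr fun x _ => ?_
    simp only [flux_re (him t)]
    ring
  simp only [e1, e3] at h1
  simp only [e2, e4] at h2
  have h := ((h1.ofReal_comp.sub (h2.ofReal_comp.const_mul Complex.I)).const_mul
    (1 / (2 * Real.pi) : ℂ)).const_mul ((weight k : ℂ)⁻¹)
  have hwc : (weight k : ℂ) ≠ 0 := by exact_mod_cast hw
  convert! h using 1
  · funext s
    rw [fhat_eq_cos_sin k (him s)]
    push_cast
    simp only [Pi.sub_apply]
    field_simp
  · rw [fhat_eq_cos_sin k (flux_im (him t)), symb]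
    push_cast
    linear_combination (-(k : ℂ) * (weight k : ℂ)⁻¹ * (1 / (2 * Real.pi) : ℂ) *
      (∫ x in (0 : ℝ)..(2 * Real.pi), (flux (U t) (x : Torus)).re * Real.sin (k * x) : ℝ)) *
      (-Complex.I_sq)

/-- The primitive of the continuous right-hand side has the same Fourier coefficients as `U`, which
upgrades coefficientwise differentiability to the sup norm. -/
lemma hasDerivAt_of_fhat {U : ℝ → CTorus} (hU : Continuous U)
    (h : ∀ k t, HasDerivAt (fun t => fhat k (U t)) (symb k * fhat k (flux (U t))) t) (t : ℝ) :
    HasDerivAt U (smoothing (flux (U t))) t := by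
  have hc : Continuous fun t => smoothing (flux (U t)) :=
    smoothing.continuous.comp (continuous_flux.comp hU)
  set J : ℝ → CTorus := fun t => U 0 + ∫ s in (0 : ℝ)..t, smoothing (flux (U s)) with hJ
  have hJd : ∀ t, HasDerivAt J (smoothing (flux (U t))) t := fun t =>
    (hc.integral_hasStrictDerivAt 0 t).hasDerivAt.const_add _
  have hUJ : U = J := by
    funext t
    refine fhat_ext fun k => ?_
    have hd : ∀ t, HasDerivAt (fun t => fhat k (U t) - fhat k (J t)) 0 t := fun t => by
      have h1 := ((fhat k).restrictScalars ℝ).hasFDerivAt.comp_hasDerivAt t (hJd t)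
      have := (h k t).sub h1
      convert! this using 1
      simp [fhat_smoothing]
    have := is_const_of_deriv_eq_zero (fun t => (hd t).differentiableAt) (fun t => (hd t).deriv) t 0
    simp only [hJ, intervalIntegral.integral_same, add_zero, sub_self] at this
    exact sub_eq_zero.1 this
  have := hJd t
  rwa [← hUJ] at this

/-! ### Conservation laws -/

/-- `U` solves `U' = -∂ₓ (1 - ∂ₓ²)⁻¹ (U + U² / 2)`. -/
def SolvesODE (U : ℝ → CTorus) : Prop := ∀ t, HasDerivAt U (smoothing (flux (U t))) t

variable {U : ℝ → CTorus}

lemma SolvesODE.hasDerivAt_fhat (hU : SolvesODE U) (k : ℤ) (t : ℝ) :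
    HasDerivAt (fun t => fhat k (U t)) (symb k * fhat k (flux (U t))) t := by
  have := ((fhat k).restrictScalars ℝ).hasFDerivAt.comp_hasDerivAt t (hU t)
  convert! this using 1
  simp [fhat_smoothing]

lemma SolvesODE.avg_eq (hU : SolvesODE U) (t : ℝ) : avg (U t) = avg (U 0) := by
  have h0 : ∀ f : CTorus, fhat 0 f = avg f := fun f => by
    rw [fhat_apply]
    congr 1
    ext x
    simp
  have hd : ∀ t, HasDerivAt (fun t => avg (U t)) 0 t := fun t => by
    have := hU.hasDerivAt_fhat 0 t
    simp only [h0] at this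
    simpa [symb] using this
  exact is_const_of_deriv_eq_zero (fun t => (hd t).differentiableAt) (fun t => (hd t).deriv) t 0

/-- With `N = u + u² / 2`, the integrand has derivative `3u²u' + 6uu' = 6 N u' = 6 N · K N`, whose
mean vanishes because `K` is antisymmetric. -/
lemma SolvesODE.avg_cubic_eq (hU : SolvesODE U) (t : ℝ) :
    avg (U t * U t * U t + 3 * (U t * U t)) = avg (U 0 * U 0 * U 0 + 3 * (U 0 * U 0)) := by
  have hd : ∀ t, HasDerivAt (fun t => avg (U t * U t * U t + 3 * (U t * U t))) 0 t := fun t => by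
    have h2 := (hU t).mul (hU t)
    have h := (avg.restrictScalars ℝ).hasFDerivAt.comp_hasDerivAt t
      ((h2.mul (hU t)).add (h2.const_mul 3))
    convert! h using 1
    have h3 : (smoothing (flux (U t)) * U t + U t * smoothing (flux (U t))) * U t +
        (U t * U t) * smoothing (flux (U t)) +
        3 * (smoothing (flux (U t)) * U t + U t * smoothing (flux (U t))) =
        (6 : ℂ) • (flux (U t) * smoothing (flux (U t))) := by
      ext x
      simp only [ContinuousMap.add_apply, ContinuousMap.mul_apply, ContinuousMap.smul_apply,
        flux_apply, smul_eq_mul]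
      have : (3 : CTorus) x = 3 := rfl
      rw [this]
      ring
    simp only [ContinuousLinearMap.coe_restrictScalars']
    rw [Pi.mul_apply, h3, map_smul, avg_mul_smoothing, smul_zero]
  exact is_const_of_deriv_eq_zero (fun t => (hd t).differentiableAt) (fun t => (hd t).deriv) t 0

/-! ### Conservation of the `H¹` energy. -/

lemma fhat_neg {f : CTorus} (hf : ∀ x, (f x).im = 0) (k : ℤ) :
    fhat (-k) f = (starRingEnd ℂ) (fhat k f) := by
  rw [fhat_apply, fhat_apply, avg_apply, avg_apply, ← integral_conj]
  refine integral_congr_ae (ae_of_all _ fun x => ?_)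
  simp only [ContinuousMap.mul_apply, map_mul, Complex.conj_eq_iff_im.2 (hf x)]
  rw [fourier_neg (n := -k)]

/-- The part of the `H¹` energy in the frequencies at most `N`. -/
def partialEnergy (N : ℕ) (f : CTorus) : ℝ :=
  ∑ k ∈ Finset.Icc (-(N : ℤ)) N, weight k * ‖fhat k f‖ ^ 2

lemma partialEnergy_eq {f : CTorus} (hf : ∀ x, (f x).im = 0) (N : ℕ) :
    (partialEnergy N f : ℂ) =
      ∑ k ∈ Finset.Icc (-(N : ℤ)) N, (weight k : ℂ) * (fhat k f * fhat (-k) f) := by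
  rw [partialEnergy]
  push_cast
  refine Finset.sum_congr rfl fun k _ => ?_
  rw [fhat_neg hf, Complex.mul_conj']

lemma tendsto_partialEnergy {A : ℝ} {f : CTorus} (h : SobolevBound A f) :
    Tendsto (fun N => partialEnergy N f) atTop (𝓝 (∑' k, weight k * ‖fhat k f‖ ^ 2)) :=
  h.1.hasSum.comp (Finset.tendsto_Icc_neg (R := ℤ))

lemma SolvesODE.hasDerivAt_partialEnergy (hU : SolvesODE U) (him : ∀ t x, (U t x).im = 0)
    (N : ℕ) (t : ℝ) :
    HasDerivAt (fun t => (partialEnergy N (U t) : ℂ))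
      (∑ k ∈ Finset.Icc (-(N : ℤ)) N, Complex.I * k * fhat k (U t) * fhat (-k) (U t * U t)) t := by
  have h : HasDerivAt (fun t => (partialEnergy N (U t) : ℂ)) (∑ k ∈ Finset.Icc (-(N : ℤ)) N,
      (weight k : ℂ) * (symb k * fhat k (flux (U t)) * fhat (-k) (U t) +
        fhat k (U t) * (symb (-k) * fhat (-k) (flux (U t))))) t := by
    simp only [fun t => partialEnergy_eq (him t) N]
    exact HasDerivAt.fun_sum fun k _ =>
      ((hU.hasDerivAt_fhat k t).mul (hU.hasDerivAt_fhat (-k) t)).const_mul _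
  convert! h using 1
  have hflux : ∀ k, fhat k (flux (U t)) = fhat k (U t) + fhat k (U t * U t) / 2 := fun k => by
    have : flux (U t) = U t + (2⁻¹ : ℂ) • (U t * U t) := by
      ext x
      simp [flux_apply]
      ring
    rw [this, map_add, map_smul, smul_eq_mul]
    ring
  -- The symmetry `k ↦ -k` identifies the two halves of the cubic term; the quadratic terms cancel
  -- since the symbol is odd.
  have hodd : ∑ k ∈ Finset.Icc (-(N : ℤ)) N,
      Complex.I * k * fhat k (U t) * fhat (-k) (U t * U t) =
      ∑ k ∈ Finset.Icc (-(N : ℤ)) N,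
        -(Complex.I * k * fhat (-k) (U t) * fhat k (U t * U t)) := by
    refine Finset.sum_equiv (Equiv.neg ℤ) (fun k => ?_) fun k _ => ?_
    · simp only [Finset.mem_Icc, Equiv.neg_apply]
      omega
    · simp
  have hterm : ∀ k : ℤ, (weight k : ℂ) * (symb k * fhat k (flux (U t)) * fhat (-k) (U t) +
        fhat k (U t) * (symb (-k) * fhat (-k) (flux (U t)))) =
      1 / 2 * (Complex.I * k * fhat k (U t) * fhat (-k) (U t * U t)) +
      1 / 2 * -(Complex.I * k * fhat (-k) (U t) * fhat k (U t * U t)) := fun k => by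
    rw [hflux, hflux, symb_neg]
    linear_combination ((fhat k (U t) + fhat k (U t * U t) / 2) * fhat (-k) (U t) -
      fhat k (U t) * (fhat (-k) (U t) + fhat (-k) (U t * U t) / 2)) * weight_mul_symb k
  simp only [hterm]
  rw [Finset.sum_add_distrib, ← Finset.mul_sum, ← Finset.mul_sum, ← hodd]
  ring

/-- The truncated energies have derivatives tending to `0` uniformly on the compact interval, so the
mean value inequality passes to the limit. -/
lemma SolvesODE.energy_eq (hU : SolvesODE U) (him : ∀ t x, (U t x).im = 0)
    (hb : ∀ a b, ∃ A, 0 ≤ A ∧ ∀ t ∈ Icc a b, SobolevBound A (U t)) (t : ℝ) :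
    ∑' k, weight k * ‖fhat k (U t)‖ ^ 2 = ∑' k, weight k * ‖fhat k (U 0)‖ ^ 2 := by
  obtain ⟨A, hA, hAt⟩ := hb (-|t|) |t|
  have ht : t ∈ Icc (-|t|) |t| := ⟨neg_abs_le t, le_abs_self t⟩
  have h0 : (0 : ℝ) ∈ Icc (-|t|) |t| := ⟨by simp, abs_nonneg t⟩
  have hlim := ((tendsto_partialEnergy (hAt t ht)).sub
    (tendsto_partialEnergy (hAt 0 h0))).norm
  have hle : ∀ N : ℕ, ‖partialEnergy N (U t) - partialEnergy N (U 0)‖ ≤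
      3 * tailConst ∅ * tailConst (Finset.Icc (-(N : ℤ)) N) * A ^ 3 * ‖t - 0‖ := fun N => by
    have := (convex_Icc (-|t|) |t|).norm_image_sub_le_of_norm_hasDerivWithin_le
      (fun s _ => (hU.hasDerivAt_partialEnergy him N s).hasDerivWithinAt)
      (fun s hs => (hAt s hs).norm_sum_le hA _) h0 ht
    rwa [← Complex.ofReal_sub, Complex.norm_real] at this
  have hz : Tendsto (fun N : ℕ => 3 * tailConst ∅ * tailConst (Finset.Icc (-(N : ℤ)) N) * A ^ 3 *
      ‖t - 0‖) atTop (𝓝 0) := by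
    have := ((((tendsto_tailConst.comp (Finset.tendsto_Icc_neg (R := ℤ))).const_mul
      (3 * tailConst ∅)).mul_const (A ^ 3)).mul_const ‖t - 0‖)
    simpa using this
  have := le_of_tendsto_of_tendsto' hlim hz hle
  exact sub_eq_zero.1 (norm_le_zero_iff.1 this)

lemma SolvesODE.exists_sobolevBound (hU : SolvesODE U) (him : ∀ t x, (U t x).im = 0)
    (hb : ∀ a b, ∃ A, 0 ≤ A ∧ ∀ t ∈ Icc a b, SobolevBound A (U t)) :
    ∃ A, 0 ≤ A ∧ ∀ t, SobolevBound A (U t) := by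
  obtain ⟨A, hA, hA0⟩ := hb 0 0
  refine ⟨A, hA, fun t => ?_⟩
  obtain ⟨B, _, hB⟩ := hb t t
  refine ⟨(hB t (by simp)).1, ?_⟩
  rw [hU.energy_eq him hb]
  exact (hA0 0 (by simp)).2

lemma SolvesODE.eq_zero (hU : SolvesODE U) (him : ∀ t x, (U t x).im = 0)
    (hb : ∀ a b, ∃ A, 0 ≤ A ∧ ∀ t ∈ Icc a b, SobolevBound A (U t)) (h0 : U 0 = 0) (t : ℝ) :
    U t = 0 := by
  obtain ⟨B, _, hB⟩ := hb t t
  have hs := (hB t (by simp)).1.hasSum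
  rw [hU.energy_eq him hb, h0] at hs
  simp only [map_zero, norm_zero, ne_eq, OfNat.ofNat_ne_zero, not_false_eq_true, zero_pow,
    mul_zero, tsum_zero] at hs
  refine fhat_ext fun k => ?_
  have := congrFun ((hasSum_zero_iff_of_nonneg fun k =>
    mul_nonneg (weight_pos k).le (sq_nonneg _)).1 hs) k
  simpa [(weight_pos k).ne'] using this

/-! ### Propagation of zeros in time -/

lemma SolvesODE.apply_eq_zero (hU : SolvesODE U) {M : ℝ} (hM : ∀ t, ‖U t‖ ≤ M) {x : Torus} {T : ℝ}
    (hT : 0 < T) (h0 : ∀ t ∈ Ioo 0 T, U t x = 0) {t : ℝ} (ht : 0 ≤ t) : U t x = 0 := by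
  set K : CTorus →L[ℝ] CTorus := smoothing.restrictScalars ℝ with hK
  set ev : CTorus →L[ℝ] ℂ := (ContinuousMap.evalCLM ℂ x).restrictScalars ℝ with hev
  have hevle : ∀ f, ‖ev f‖ ≤ ‖f‖ := fun f => f.norm_coe_le_norm x
  have hM0 : 0 ≤ M := (norm_nonneg _).trans (hM 0)
  -- Evaluation at `x` does not increase norms, so the global bounds apply; the `+ 1` only makes `R`
  -- positive.
  have key := eq_zero_of_taylor (g := fun n t => ev (taylorCoeff K (U t) n))
    (M := M) (R := ‖K‖ * (1 + M) + 1) (T := T)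
    (fun n t => by
      have := ev.hasFDerivAt.comp_hasDerivAt t (hasDerivAt_taylorCoeff K hU n t)
      simpa [Function.comp_def] using this) hM0 (by positivity)
    (fun n t => by
      refine (hevle _).trans ((norm_taylorCoeff_le K (hM t) n).trans ?_)
      gcongr
      linarith) hT
    (fun t ht => by simpa [taylorCoeff_zero, hev] using h0 t ht) ht
  simpa [taylorCoeff_zero, hev] using key

/-! ### A multiplier with constant derivative outside an open set -/

/-- On the compact complement of `W` the cosine attains its maximum, and it equals `1` only at `x₀`,
which lies in `W`. -/
lemma exists_cos_le {W : Set Torus} (hW : IsOpen W) {x₀ : ℝ} (hx₀ : (x₀ : Torus) ∈ W) :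
    ∃ c < 1, ∀ x : ℝ, (x : Torus) ∉ W → Real.cos (x - x₀) ≤ c := by
  have hcos : ∀ x : ℝ, (fourier 1 ((x : Torus) - (x₀ : Torus))).re = Real.cos (x - x₀) := by
    intro x
    have : (Real.pi : ℂ) ≠ 0 := by exact_mod_cast Real.pi_ne_zero
    rw [← AddCircle.coe_sub, fourier_coe_apply,
      show (2 * Real.pi * Complex.I * (1 : ℤ) * ((x - x₀ : ℝ) : ℂ) / ((2 * Real.pi : ℝ) : ℂ)) =
        ((x - x₀ : ℝ) : ℂ) * Complex.I by push_cast; field_simp, Complex.exp_ofReal_mul_I_re]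
  have hcont : Continuous fun y : Torus => (fourier 1 (y - (x₀ : Torus))).re := by fun_prop
  rcases Wᶜ.eq_empty_or_nonempty with he | hne
  · exact ⟨0, one_pos, fun x hx => absurd (he ▸ hx : (x : Torus) ∈ (∅ : Set Torus)) (by simp)⟩
  · obtain ⟨y, hy, hmax⟩ := hW.isClosed_compl.isCompact.exists_isMaxOn hne hcont.continuousOn
    obtain ⟨z, rfl⟩ := QuotientAddGroup.mk_surjective y
    refine ⟨Real.cos (z - x₀), lt_of_le_of_ne (Real.cos_le_one _) fun h => hy ?_, fun x hx => ?_⟩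
    · obtain ⟨n, hn⟩ := (Real.cos_eq_one_iff _).1 h
      have : (z : Torus) = (x₀ : Torus) := by
        rw [← sub_eq_zero, ← AddCircle.coe_sub, ← hn, AddCircle.coe_eq_zero_iff]
        exact ⟨n, by simp⟩
      exact this ▸ hx₀
    · rw [← hcos, ← hcos]
      exact hmax hx

/-- A periodic function needs a derivative of mean zero, so the excess is compensated by a bump `b`
vanishing outside `W`. -/
lemma exists_periodic_deriv_eq_one {W : Set Torus} (hW : IsOpen W) (hne : W.Nonempty) :
    ∃ ψ : ℝ → ℝ, ContDiff ℝ ∞ ψ ∧ Function.Periodic ψ (2 * Real.pi) ∧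
      ∀ x : ℝ, (x : Torus) ∉ W → deriv ψ x = 1 := by
  obtain ⟨y, hy⟩ := hne
  obtain ⟨x₀, rfl⟩ := QuotientAddGroup.mk_surjective y
  obtain ⟨c, hc1, hc⟩ := exists_cos_le hW hy
  -- Positive exactly where `cos (x - x₀) > c`, hence only in `W`, and periodic by construction.
  set b : ℝ → ℝ := fun x => Real.smoothTransition (Real.cos (x - x₀) - c) with hb
  have hbs : ContDiff ℝ ∞ b := by
    refine Real.smoothTransition.contDiff.comp ?_
    fun_prop
  have hbp : Function.Periodic b (2 * Real.pi) := fun x => by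
    simp only [hb]
    rw [show x + 2 * Real.pi - x₀ = x - x₀ + 2 * Real.pi by ring, Real.cos_add_two_pi]
  have hb0 : ∀ x, 0 ≤ b x := fun x => Real.smoothTransition.nonneg _
  have hbW : ∀ x : ℝ, (x : Torus) ∉ W → b x = 0 := fun x hx =>
    Real.smoothTransition.zero_of_nonpos (by linarith [hc x hx])
  have hI : 0 < ∫ x in (0 : ℝ)..(2 * Real.pi), b x := by
    have h1 : ∫ x in (0 : ℝ)..(2 * Real.pi), b x = ∫ x in x₀..(x₀ + 2 * Real.pi), b x := by
      simpa using hbp.intervalIntegral_add_eq 0 x₀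
    rw [h1]
    refine intervalIntegral.integral_pos (by linarith [Real.pi_pos]) hbs.continuous.continuousOn
      (fun x _ => hb0 x) ⟨x₀, left_mem_Icc.2 (by linarith [Real.pi_pos]), ?_⟩
    simp only [hb, sub_self, Real.cos_zero]
    exact Real.smoothTransition.pos_of_pos (by linarith)
  set I := ∫ x in (0 : ℝ)..(2 * Real.pi), b x with hIdef
  -- The factor `2π / I` gives `φ` mean zero over a period.
  set φ : ℝ → ℝ := fun x => 1 - 2 * Real.pi / I * b x with hφ
  have hφs : ContDiff ℝ ∞ φ := contDiff_const.sub (contDiff_const.mul hbs)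
  have hφc := hφs.continuous
  have hφp : Function.Periodic φ (2 * Real.pi) := fun x => by
    simp only [hφ]
    rw [hbp]
  have hφI : ∫ x in (0 : ℝ)..(2 * Real.pi), φ x = 0 := by
    simp only [hφ]
    have hbi : IntervalIntegrable (fun x => 2 * Real.pi / I * b x) volume 0 (2 * Real.pi) :=
      (continuous_const.mul hbs.continuous).intervalIntegrable _ _
    rw [intervalIntegral.integral_sub intervalIntegrable_const hbi,
      intervalIntegral.integral_const_mul, ← hIdef, div_mul_cancel₀ _ hI.ne']
    simp
  have hd : ∀ x, HasDerivAt (fun x => ∫ s in (0 : ℝ)..x, φ s) (φ x) x := fun x =>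
    (hφc.integral_hasStrictDerivAt 0 x).hasDerivAt
  have hderiv : deriv (fun x => ∫ s in (0 : ℝ)..x, φ s) = φ := funext fun x => (hd x).deriv
  refine ⟨fun x => ∫ s in (0 : ℝ)..x, φ s, ?_, fun x => ?_, fun x hx => ?_⟩
  · rw [contDiff_infty_iff_deriv, hderiv]
    exact ⟨fun x => (hd x).differentiableAt, hφs⟩
  · have h1 : ∫ s in x..(x + 2 * Real.pi), φ s = 0 := by
      rw [hφp.intervalIntegral_add_eq x 0, zero_add, hφI]
    have h2 := intervalIntegral.integral_add_adjacent_intervals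
      (hφc.intervalIntegrable 0 x) (hφc.intervalIntegrable (μ := volume) x (x + 2 * Real.pi))
    simp only
    rw [← h2, h1, add_zero]
  · rw [hderiv]
    simp [hφ, hbW x hx]

/-! ### Real parts of mean values -/

lemma re_avg_haar (f : CTorus) :
    (avg f).re = ∫ x, (f x).re ∂(AddCircle.haarAddCircle (T := 2 * Real.pi)) :=
  (integral_re (integrable_haar f)).symm

lemma re_avg_interval (f : CTorus) :
    ∫ x in (0 : ℝ)..(2 * Real.pi), (f (x : Torus)).re = 2 * Real.pi * (avg f).re := by
  have h := Complex.reCLM.intervalIntegral_comp_comm (a := 0) (b := 2 * Real.pi) (μ := volume)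
    (f := fun x : ℝ => f (x : Torus))
    ((f.continuous.comp (AddCircle.continuous_mk' _)).intervalIntegrable _ _)
  simp only [Complex.reCLM_apply] at h
  have := Real.pi_ne_zero
  rw [avg_eq_intervalIntegral, Complex.smul_re, ← h, smul_eq_mul]
  field_simp

lemma integral_volume_eq (f : Torus → ℝ) :
    ∫ x, f x = 2 * Real.pi * ∫ x, f x ∂(AddCircle.haarAddCircle (T := 2 * Real.pi)) := by
  have := Real.pi_ne_zero
  rw [AddCircle.integral_haarAddCircle, smul_eq_mul]
  field_simp

/-! ### Unique continuation -/

lemma avg_mul_self_re_nonneg {f : CTorus} (hf : ∀ x, (f x).im = 0) : 0 ≤ (avg (f * f)).re := by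
  rw [re_avg_haar]
  refine integral_nonneg fun x => ?_
  simp [hf, mul_self_nonneg]

lemma abs_avg_cubic_le {f : CTorus} (hf : ∀ x, (f x).im = 0) :
    |(avg (f * f * f + 3 * (f * f))).re| ≤ (‖f‖ + 3) * (avg (f * f)).re := by
  rw [re_avg_haar, re_avg_haar, ← integral_const_mul, ← Real.norm_eq_abs]
  refine norm_integral_le_of_norm_le ?_ (ae_of_all _ fun x => ?_)
  · exact ((Complex.continuous_re.comp (f * f).continuous).integrable_of_hasCompactSupport
      (HasCompactSupport.of_compactSpace _)).const_mul _
  · have h3 : (3 : CTorus) x = 3 := rfl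
    have h1 : |(f x).re| ≤ ‖f‖ := (Complex.abs_re_le_norm _).trans (f.norm_coe_le_norm x)
    simp only [ContinuousMap.add_apply, ContinuousMap.mul_apply, h3]
    have h2 : (f x * f x * f x + 3 * (f x * f x)).re = ((f x).re + 3) * ((f x).re * (f x).re) := by
      simp [hf]
      ring
    have h4 : (f x * f x).re = (f x).re * (f x).re := by simp [hf]
    rw [h2, h4, norm_mul, Real.norm_of_nonneg (mul_self_nonneg _), Real.norm_eq_abs]
    refine mul_le_mul_of_nonneg_right ?_ (mul_self_nonneg _)
    refine (abs_add_le _ _).trans ?_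
    rw [abs_of_pos (by norm_num : (0 : ℝ) < 3)]
    linarith

/-- Outside `W`, the multiplier `ψ` gives a functional of `U` which is bounded and grows at the
rate `∫ u + ½ ∫ u²`; so the cubic invariant vanishes. -/
lemma avg_cubic_eq_zero_of_multiplier (hU : SolvesODE U) (him : ∀ t x, (U t x).im = 0) {M : ℝ}
    (hM : ∀ t, ‖U t‖ ≤ M) (hmean : 0 ≤ (avg (U 0)).re) {W : Set Torus} {ψ : ℝ → ℝ}
    (hψ : ContDiff ℝ ∞ ψ) (hψW : ∀ x : ℝ, (x : Torus) ∉ W → deriv ψ x = 1)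
    (hd : ∀ t, HasDerivAt (fun t => ∫ x in (0 : ℝ)..(2 * Real.pi),
        (U t (x : Torus)).re * (ψ x - deriv (deriv ψ) x))
      (∫ x in (0 : ℝ)..(2 * Real.pi),
        ((U t (x : Torus)).re + (U t (x : Torus)).re ^ 2 / 2) * deriv ψ x) t)
    (hz : ∀ t, 0 ≤ t → ∀ x ∈ W, U t x = 0) :
    (avg (U 0 * U 0 * U 0 + 3 * (U 0 * U 0))).re = 0 := by
  set F : ℝ → ℝ := fun t => ∫ x in (0 : ℝ)..(2 * Real.pi),
    (U t (x : Torus)).re * (ψ x - deriv (deriv ψ) x) with hF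
  set I := (avg (U 0 * U 0 * U 0 + 3 * (U 0 * U 0))).re with hI
  have hM0 : 0 ≤ M := (norm_nonneg _).trans (hM 0)
  have hψ1 : ContDiff ℝ ∞ (deriv ψ) := (contDiff_infty_iff_deriv.1 hψ).2
  have hm : Continuous fun x => ψ x - deriv (deriv ψ) x :=
    hψ.continuous.sub (contDiff_infty_iff_deriv.1 hψ1).2.continuous
  obtain ⟨C, hC⟩ := (isCompact_Icc (a := (0 : ℝ)) (b := 2 * Real.pi)).exists_bound_of_continuousOn
    hm.continuousOn
  have hFb : ∀ t, |F t| ≤ M * C * (2 * Real.pi) := fun t => by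
    have := intervalIntegral.norm_integral_le_of_norm_le_const (a := (0 : ℝ)) (b := 2 * Real.pi)
      (C := M * C) (f := fun x : ℝ => (U t (x : Torus)).re * (ψ x - deriv (deriv ψ) x))
      fun x hx => by
        rw [uIoc_of_le (by positivity)] at hx
        rw [norm_mul]
        have h1 : ‖(U t (x : Torus)).re‖ ≤ M :=
          (Complex.abs_re_le_norm _).trans (((U t).norm_coe_le_norm _).trans (hM t))
        exact mul_le_mul h1 (hC x (Ioc_subset_Icc_self hx)) (norm_nonneg _) hM0
    rwa [sub_zero, abs_of_pos Real.two_pi_pos] at this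
  -- On `W` the flux vanishes and off `W` the weight `deriv ψ` is `1`, so the weight may be dropped.
  have hG : ∀ t, 0 ≤ t → ∫ x in (0 : ℝ)..(2 * Real.pi),
      ((U t (x : Torus)).re + (U t (x : Torus)).re ^ 2 / 2) * deriv ψ x =
      2 * Real.pi * ((avg (U 0)).re + (avg (U t * U t)).re / 2) := fun t ht => by
    have h1 : (avg (U 0)).re + (avg (U t * U t)).re / 2 = (avg (flux (U t))).re := by
      have : flux (U t) = U t + (2⁻¹ : ℂ) • (U t * U t) := by
        ext x
        simp [flux_apply]
        ring
      rw [this, map_add, map_smul, hU.avg_eq t]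
      have h2 : (2⁻¹ : ℂ) = ((2⁻¹ : ℝ) : ℂ) := by push_cast; rfl
      rw [Complex.add_re, smul_eq_mul, h2, Complex.re_ofReal_mul]
      ring
    rw [h1, ← re_avg_interval]
    refine intervalIntegral.integral_congr fun x _ => ?_
    simp only [flux_re (him t)]
    by_cases hx : (x : Torus) ∈ W
    · simp [hz t ht _ hx]
    · rw [hψW x hx, mul_one]
  by_contra hne
  -- The rate `2π · ½ · avg u²`, with `avg u² ≥ |I| / (M + 3)`; the mean of `u` only helps.
  set δ := Real.pi * (|I| / (M + 3)) with hδ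
  have hδ0 : 0 < δ := by
    have : 0 < |I| := abs_pos.2 hne
    have := Real.pi_pos
    positivity
  have hGδ : ∀ t, 0 ≤ t → δ ≤ ∫ x in (0 : ℝ)..(2 * Real.pi),
      ((U t (x : Torus)).re + (U t (x : Torus)).re ^ 2 / 2) * deriv ψ x := fun t ht => by
    rw [hG t ht]
    have h1 := abs_avg_cubic_le (him t)
    rw [hU.avg_cubic_eq t] at h1
    have h2 : |I| ≤ (M + 3) * (avg (U t * U t)).re :=
      h1.trans (mul_le_mul_of_nonneg_right (by linarith [hM t]) (avg_mul_self_re_nonneg (him t)))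
    have h3 : |I| / (M + 3) ≤ (avg (U t * U t)).re := by
      rw [div_le_iff₀ (by positivity)]
      linarith
    have := Real.pi_pos
    rw [hδ]
    nlinarith [mul_le_mul_of_nonneg_left h3 this.le, mul_nonneg this.le hmean]
  -- By this time `F` has grown by `2B + 1`, with `B` the bound on `|F|`, which is impossible.
  set t₁ := (2 * (M * C * (2 * Real.pi)) + 1) / δ with ht₁
  have hB0 : 0 ≤ M * C * (2 * Real.pi) := (abs_nonneg _).trans (hFb 0)
  have ht₁0 : 0 ≤ t₁ := by positivity
  have hgrow := (convex_Ici (0 : ℝ)).mul_sub_le_image_sub_of_le_deriv (f := F) (C := δ)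
    (fun t _ => (hd t).continuousAt.continuousWithinAt)
    (fun t _ => (hd t).differentiableAt.differentiableWithinAt)
    (fun t ht => by
      rw [interior_Ici] at ht
      rw [(hd t).deriv]
      exact hGδ t (le_of_lt ht)) 0 (by simp) t₁ ht₁0 ht₁0
  rw [sub_zero, ht₁, mul_div_cancel₀ _ hδ0.ne', ← ht₁] at hgrow
  have h1 := abs_le.1 (hFb t₁)
  have h2 := abs_le.1 (hFb 0)
  linarith [h1.2, h2.1]

/-- The integrand `(f + 3) f²` is nonnegative, and its first factor is positive almost everywhere.
-/
lemma eq_zero_of_avg_cubic_eq_zero {f : CTorus} (hf : ∀ x, (f x).im = 0)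
    (h3 : ∀ᵐ x, -3 < (f x).re) (h : (avg (f * f * f + 3 * (f * f))).re = 0) : f = 0 := by
  have hval : ∀ x, ((f * f * f + 3 * (f * f)) x).re = ((f x).re + 3) * ((f x).re * (f x).re) :=
    fun x => by
      have h3 : (3 : CTorus) x = 3 := rfl
      simp only [ContinuousMap.add_apply, ContinuousMap.mul_apply, h3]
      simp [hf]
      ring
  have h3' := ae_volume_iff_ae_haar.1 h3
  rw [re_avg_haar, integral_eq_zero_iff_of_nonneg_ae] at h
  · have hae : ∀ᵐ x, f x = (0 : CTorus) x := by
      rw [ae_volume_iff_ae_haar]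
      filter_upwards [h, h3'] with x hx hx3
      rw [hval, Pi.zero_apply, mul_eq_zero, mul_self_eq_zero] at hx
      refine Complex.ext ?_ (hf x)
      rcases hx with hx | hx
      · linarith
      · exact hx
    exact DFunLike.coe_injective (eq_of_ae_eq f.continuous (0 : CTorus).continuous hae)
  · filter_upwards [h3'] with x hx
    rw [hval, Pi.zero_apply]
    exact mul_nonneg (by linarith) (mul_self_nonneg _)
  · exact (Complex.continuous_re.comp (ContinuousMap.continuous _)).integrable_of_hasCompactSupport
      (HasCompactSupport.of_compactSpace _)

lemma eq_zero_on_of_ae {f : CTorus} {W : Set Torus} (hW : IsOpen W)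
    (h : ∀ᵐ x, x ∈ W → f x = 0) : ∀ x ∈ W, f x = 0 := by
  have ho : IsOpen (W ∩ {x | f x ≠ 0}) := hW.inter (isOpen_ne_fun f.continuous continuous_const)
  have hm : volume (W ∩ {x | f x ≠ 0}) = 0 := by
    rw [ae_iff] at h
    convert! h using 2
    ext x
    simp
  have he := (ho.measure_eq_zero_iff volume).1 hm
  intro x hx
  by_contra hne
  exact (he ▸ (⟨hx, hne⟩ : x ∈ W ∩ {x | f x ≠ 0}) : x ∈ (∅ : Set Torus))

end BBM

end

/-! ### The unique continuation theorem. -/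

open BBM in
theorem theorem3p1 (u₀ : BBM.Torus → ℝ) (hu₀ : BBM.MemHs 1 u₀)
    (hmean : 0 ≤ ∫ x : BBM.Torus, u₀ x)
    (hsup : eLpNorm u₀ ⊤ volume < 3)
    (u : ℝ → BBM.Torus → ℝ) (hu : BBM.IsSolution 1 u₀ u)
    (ω : Set BBM.Torus) (hω : IsOpen ω) (hω' : ω.Nonempty) (T : ℝ) (hT : 0 < T)
    (hvanish : ∀ t ∈ Ioo (0 : ℝ) T, ∀ᵐ x : BBM.Torus, x ∈ ω → u t x = 0) :
    u₀ =ᵐ[volume] 0 ∧ ∀ t : ℝ, u t =ᵐ[volume] 0 := by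
  have hmem := hu.continuousInHs.1
  have hae : ∀ t, ∀ᵐ x, rep (u t) x = (u t x : ℂ) := fun t => (hmem t).rep_ae_eq
  have him : ∀ t x, (rep (u t) x).im = 0 := fun t => (hmem t).rep_im
  have hcont := continuous_rep hu.continuousInHs
  have hode : SolvesODE fun t => rep (u t) :=
    hasDerivAt_of_fhat hcont (hasDerivAt_fhat_of_weak hu.weak hcont hae him)
  have hloc := exists_sobolevBound_Icc hu.continuousInHs
  obtain ⟨A, hA, hAt⟩ := hode.exists_sobolevBound him hloc
  have hM : ∀ t, ‖rep (u t)‖ ≤ tailConst ∅ * A := fun t => (hAt t).norm_le hA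
  have hinit : ∀ᵐ x, (rep (u 0) x).re = u₀ x := by
    filter_upwards [hae 0, hu.initial] with x h1 h2
    rw [h1, Complex.ofReal_re, h2]
  -- Continuity makes the almost everywhere vanishing pointwise on the open set `ω`, so that each `x
  -- ∈ ω` can be followed in time.
  have hz : ∀ t, 0 ≤ t → ∀ x ∈ ω, rep (u t) x = 0 := fun t ht x hx =>
    hode.apply_eq_zero hM hT (fun s hs => eq_zero_on_of_ae hω (by
      filter_upwards [hae s, hvanish s hs] with y h1 h2 hy
      rw [h1, h2 hy, Complex.ofReal_zero]) x hx) ht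
  have hmean' : 0 ≤ (avg (rep (u 0))).re := by
    rw [← integral_congr_ae hinit, integral_volume_eq, ← re_avg_haar] at hmean
    exact nonneg_of_mul_nonneg_right hmean Real.two_pi_pos
  have hlow : ∀ᵐ x, -3 < (rep (u 0) x).re := by
    rw [eLpNorm_exponent_top] at hsup
    filter_upwards [hinit, ae_le_eLpNormEssSup (f := u₀) (μ := volume)] with x h1 h2
    rw [h1]
    have h3 : ‖u₀ x‖ₑ < 3 := h2.trans_lt hsup
    have h4 : |u₀ x| < 3 := by
      rw [← ofReal_norm, Real.norm_eq_abs] at h3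
      simpa using (ENNReal.ofReal_lt_ofReal_iff (q := 3) (by norm_num)).1 (by simpa using h3)
    exact (abs_lt.1 h4).1
  obtain ⟨ψ, hψ, hper, hψω⟩ := exists_periodic_deriv_eq_one hω hω'
  have hcubic := avg_cubic_eq_zero_of_multiplier hode him hM hmean' hψ hψω
    (hu.weak.hasDerivAt hcont hae hψ hper) hz
  have h0 : rep (u 0) = 0 := eq_zero_of_avg_cubic_eq_zero (him 0) hlow hcubic
  refine ⟨?_, fun t => ?_⟩
  · filter_upwards [hinit] with x hx
    rw [← hx, h0]
    simp
  · filter_upwards [hae t] with x hx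
    rw [hode.eq_zero him hloc h0 t] at hx
    exact Complex.ofReal_eq_zero.1 hx.symm
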